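/- Let $F$ be a finite field of characteristic $p \neq 3$ with $|F| = q = p^k$, and let $G = C_3 \times D_{10}$, where $C_n$ is the cyclic group of order $n$ and $D_{10}$ is the dihedral group of order $10$. Let $F_2$ be the extension of $F$ of degree $2$, let $FG$ be the group algebra, $U(\cdot)$ the group of units, $J(FG)$ the Jacobson radical of $FG$, $V = 1 + J(FG) \le U(FG)$, and $Z(V)$ the centre of $V$. Let $M(2,K)$ be the algebra of $2\times 2$ matrices over $K$ and $GL(2,K)$ its unit group. Here $X \cong N \rtimes H$ means that $X$ is isomorphic to the semidirect product for some action of $H$ on $N$ by automorphisms. 1. If $p = 2$, then $q \equiv 1, 4, 2$ or $-7 \pmod{15}$, and $$U(FG) \cong \begin{cases} C_2^{3k} \rtimes \big(C_{2^k-1}^3 \times GL(2,F)^6\big), & q \equiv 1, 4 \pmod{15},\\ C_2^{3k} \rtimes \big(C_{2^k-1} \times C_{2^{2k}-1} \times GL(2,F_2)^3\big), & q \equiv 2, -7 \pmod{15}.\end{cases}$$ 2. If $p = 5$, then $q \equiv \pm 1 \pmod 6$, and $U(FG) \cong V \rtimes U(FC_6)$, where $$U(FC_6) \cong \begin{cases}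 C_{5^k-1}^6, & q \equiv 1 \pmod 6,\\ C_{5^k-1}^2 \times C_{5^{2k}-1}^2, & q \equiv -1 \pmod 6;\end{cases}$$ thus $U(FG)$ is isomorphic to $V \rtimes C_{5^k-1}^6$, respectively $V \rtimes (C_{5^k-1}^2 \times C_{5^{2k}-1}^2)$. Moreover $V \cong (C_5^{15k} \rtimes C_5^{6k}) \rtimes C_5^{3k}$ and $Z(V) \cong C_5^{9k}$. 3. If $p > 5$, then $FG$ is semisimple, $q \equiv \pm 1, \pm 7, \pm 11$ or $\pm 13 \pmod{30}$, and, as $F$-algebras and as groups respectively, - if $q \equiv 1, -11 \pmod{30}$, then $FG \cong F^6 \oplus M(2,F)^6$ and $U(FG) \cong C_{p^k-1}^6 \times GL(2,F)^6$; - if $q \equiv -1, 11 \pmod{30}$, then $FG \cong F^2 \oplus F_2^2 \oplus M(2,F)^2 \oplus M(2,F_2)^2$ and $U(FG) \cong C_{p^k-1}^2 \times C_{p^{2k}-1}^2 \times GL(2,F)^2 \times GL(2,F_2)^2$; - if $q \equiv 7, 13 \pmod{30}$, then $FG \cong F^6 \oplus M(2,F_2)^3$ and $U(FG) \cong C_{p^k-1}^6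 \times GL(2,F_2)^3$; - if $q \equiv -7, -13 \pmod{30}$, then $FG \cong F^2 \oplus F_2^2 \oplus M(2,F_2)^3$ and $U(FG) \cong C_{p^k-1}^2 \times C_{p^{2k}-1}^2 \times GL(2,F_2)^3$. -/

import Mathlib

namespace GroupAlgebraC3D10

/-- The cyclic group `C_n`, written multiplicatively (used for `n ≥ 1` only). -/
abbrev C (n : ℕ) : Type := Multiplicative (ZMod n)

/-- The direct power `H^m` of a group (or ring) `H`. -/
abbrev DirPow (H : Type*) (m : ℕ) : Type _ := Fin m → H

/-- The group `G = C_3 × D_10`. Mathlib's `DihedralGroup n` has order `2 * n`, so the dihedral group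
of order `10` is `DihedralGroup 5`. -/
abbrev G : Type := C 3 × DihedralGroup 5

/-- The group `GL(2, R)`. -/
abbrev GL2 (R : Type*) [CommRing R] : Type _ := Matrix.GeneralLinearGroup (Fin 2) R

/-- The matrix algebra `M(2, R)`. -/
abbrev M2 (R : Type*) : Type _ := Matrix (Fin 2) (Fin 2) R

/-- The extension `F_2` of degree two of a finite field `F` of characteristic `p`. -/
abbrev QuadExt (F : Type*) [Field F] [Finite F] (p : ℕ) [Fact p.Prime] [CharP F p] : Type :=
  FiniteField.Extension F p 2

/-- The group `1 + J(R)`, where `J(R)` is the Jacobson radical of the ring `R`, as a subgroup of the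
unit group of `R`. (All elements of `1 + J(R)` are units.) -/
def oneAddJacobson (R : Type*) [Ring R] : Subgroup Rˣ where
  carrier := {u | ∃ j ∈ Ring.jacobson R, (u : R) = 1 + j}
  one_mem' := ⟨0, zero_mem _, by simp⟩
  mul_mem' := by
    rintro a b ⟨i, hi, ha⟩ ⟨j, hj, hb⟩
    refine ⟨i + (a : R) * j, add_mem hi (Ideal.mul_mem_left _ _ hj), ?_⟩
    rw [Units.val_mul, hb, mul_add, mul_one, ha]
    abel
  inv_mem' := by
    rintro a ⟨i, hi, ha⟩
    refine ⟨-((a⁻¹ : Rˣ) : R) * i, Ideal.mul_mem_left _ _ hi, ?_⟩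
    have h : ((a⁻¹ : Rˣ) : R) * (1 + i) = 1 := by rw [← ha]; exact a.inv_mul
    rw [mul_add, mul_one] at h
    rw [neg_mul, ← sub_eq_add_neg]
    exact eq_sub_of_add_eq h

/-- `X ≅ N ⋊ H`: the group `X` is isomorphic to the semidirect product of `N` and `H` for some
action of `H` on `N` by automorphisms. -/
def IsoSemidirect (X N H : Type*) [Group X] [Group N] [Group H] : Prop :=
  ∃ φ : H →* MulAut N, Nonempty (X ≃* N ⋊[φ] H)

/-- `X ≅ (A ⋊ B) ⋊ H` for some actions of `B` on `A` and of `H` on `A ⋊ B` by automorphisms. -/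
def IsoSemidirect₂ (X A B H : Type*) [Group X] [Group A] [Group B] [Group H] : Prop :=
  ∃ φ : B →* MulAut A, IsoSemidirect X (A ⋊[φ] B) H

end GroupAlgebraC3D10

/-!
Let `R = F[C₃]`, so that `F[G] = R[D₁₀]`. As `3` is invertible, `R` is `F³` if `q = 1` modulo `3`
and `F × F₂` otherwise (`nonempty_algEquiv_C_three_of_mod_eq_one`,
`nonempty_algEquiv_C_three_of_mod_eq_two`). All three parts come from an explicit description of
`R[D₁₀]` over an arbitrary finite commutative ring `R`.

If `5` is invertible in `R`, then `R[D₁₀] = R[C₂] × M₂(R[c])`, where `c² + c = 1` and `c` is the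
trace of the generating rotation (`nonempty_monoidAlgebra_dihedralGroup_five`). For a field
factor `K` of `R`, the algebra `K[c]` is `K × K` if `X² + X - 1` has a root in `K` and the quadratic
extension of `K` otherwise; the polynomial has a root in a field of `q` elements, `5 ∤ q`, exactly
if `q = ±1` modulo `5` (`exists_root_golden`, `ne_root_golden`). Away from characteristic
two, `R[C₂] = R × R`, which gives the semisimple decompositions. In characteristic two, `R[C₂]`
has unit group `R × Rˣ` (`nonempty_units_quadraticAlgebra_one_zero`), so the semidirect
product is even direct.

In characteristic five, a rotation is the exponential of a nilpotent element which the reflection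
negates, and this identifies `R[D₁₀]` with an algebra `CycAlg R` of matrices `[[a, y b], [y c, d]]`
over `R[y]/(y⁵)` with `a, b, c, d` even in `y` (`nonempty_algEquiv_cycAlg`). Its radical consists of
the matrices with nilpotent diagonal, the quotient `R × R = F[C₆]` splits off, and `V = 1 + J` has
exponent five. The coefficient of `y` in the upper right entry is a split homomorphism from `V` onto
`R`; on its kernel, the coefficients of `y` and `y²` in the lower row form a split homomorphism onto
`R²`, and what remains is elementary abelian of order `|R|⁵` (`isoSemidirect₂_V`). The centre of `V`
consists of the diagonal matrices with entries that agree modulo `y⁴` (`mem_center_V`).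
-/

namespace GroupAlgebraC3D10

open QuadraticAlgebra

/-! ### Split extensions and elementary abelian groups -/

theorem IsoSemidirect.congr {X N H X' N' H' : Type*} [Group X] [Group N] [Group H] [Group X']
    [Group N'] [Group H'] (h : IsoSemidirect X N H) (eX : X ≃* X') (eN : N ≃* N')
    (eH : H ≃* H') : IsoSemidirect X' N' H' := by
  obtain ⟨φ, ⟨e⟩⟩ := h
  exact ⟨_, ⟨eX.symm.trans (e.trans (SemidirectProduct.congr' eN eH))⟩⟩

theorem isoSemidirect_of_mulEquiv_prod {X N H : Type*} [Group X] [Group N] [Group H]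
    (e : X ≃* N × H) : IsoSemidirect X N H :=
  ⟨1, ⟨e.trans SemidirectProduct.mulEquivProd.symm⟩⟩

/-- A surjection `f` with a section `s` presents its source as a semidirect product of its kernel
and its target. -/
theorem isoSemidirect_ker {X H : Type*} [Group X] [Group H] (f : X →* H) (s : H →* X)
    (hs : ∀ h, f (s h) = h) : IsoSemidirect X f.ker H := by
  have hc : f.ker.IsComplement' s.range := by
    refine Subgroup.isComplement'_of_disjoint_and_mul_eq_univ ?_ ?_
    · rw [Subgroup.disjoint_def]
      rintro _ hx ⟨h, rfl⟩
      rw [MonoidHom.mem_ker, hs] at hx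
      rw [hx, map_one]
    · refine Set.eq_univ_of_forall fun x => ⟨x * (s (f x))⁻¹, ?_, s (f x), ⟨f x, rfl⟩, ?_⟩
      · simp [MonoidHom.mem_ker, hs]
      · simp
  have hinj : Function.Injective s := Function.LeftInverse.injective hs
  exact IsoSemidirect.congr ⟨_, ⟨(SemidirectProduct.mulEquivSubgroup hc).symm⟩⟩ (.refl _) (.refl _)
    (MonoidHom.ofInjective hinj).symm

theorem IsoSemidirect₂.congr {X A B H X' A' B' H' : Type*} [Group X] [Group A] [Group B] [Group H]
    [Group X'] [Group A'] [Group B'] [Group H'] (h : IsoSemidirect₂ X A B H) (eX : X ≃* X')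
    (eA : A ≃* A') (eB : B ≃* B') (eH : H ≃* H') : IsoSemidirect₂ X' A' B' H' := by
  obtain ⟨φ, h⟩ := h
  exact ⟨_, h.congr eX (SemidirectProduct.congr' eA eB) eH⟩

/-- A finite commutative group of prime exponent `p` and order `p ^ n` is `C_p ^ n`: it is a vector
space of dimension `n` over `ZMod p`. -/
theorem nonempty_mulEquiv_dirPow_C {A : Type*} [CommGroup A] {p n : ℕ} [Fact p.Prime]
    (hA : ∀ x : A, x ^ p = 1) (hcard : Nat.card A = p ^ n) :
    Nonempty (A ≃* DirPow (C p) n) := by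
  have hfin : Finite A := Nat.finite_of_card_ne_zero (by
    rw [hcard]; exact pow_ne_zero _ (Fact.out : p.Prime).ne_zero)
  let _ : Module (ZMod p) (Additive A) := AddCommGroup.zmodModule (n := p) fun x => hA x.toMul
  have hr : Module.finrank (ZMod p) (Additive A) = n := by
    have h1 := Module.natCard_eq_pow_finrank (K := ZMod p) (V := Additive A)
    rw [Nat.card_zmod] at h1
    exact Nat.pow_right_injective (Fact.out : p.Prime).two_le (h1.symm.trans hcard)
  have e : Additive A ≃ₗ[ZMod p] (Fin n → ZMod p) :=
    LinearEquiv.ofFinrankEq _ _ (by rw [hr, Module.finrank_fin_fun])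
  exact ⟨{ toFun := fun x i => Multiplicative.ofAdd (e (Additive.ofMul x) i)
           invFun := fun y => (e.symm fun i => (y i).toAdd).toMul
           left_inv := fun x => by simp
           right_inv := fun y => by ext i; simp
           map_mul' := fun x y => by ext i; simp }⟩

theorem nonempty_mulEquiv_of_mul_comm {A : Type*} [Group A] {p n : ℕ} [Fact p.Prime]
    (hc : ∀ x y : A, x * y = y * x) (hA : ∀ x : A, x ^ p = 1) (hcard : Nat.card A = p ^ n) :
    Nonempty (A ≃* DirPow (C p) n) :=
  letI : CommGroup A := { mul_comm := hc }
  nonempty_mulEquiv_dirPow_C hA hcard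

/-- The additive group of a ring of prime characteristic `p` and order `p ^ n` is `C_p ^ n`. -/
theorem nonempty_multiplicative_mulEquiv {R : Type*} [Ring R] {p n : ℕ} [Fact p.Prime] [CharP R p]
    (hcard : Nat.card R = p ^ n) : Nonempty (Multiplicative R ≃* DirPow (C p) n) :=
  nonempty_mulEquiv_dirPow_C (A := Multiplicative R)
    (fun x => by
      change Multiplicative.ofAdd (p • x.toAdd) = 1
      rw [nsmul_eq_mul, CharP.cast_eq_zero, zero_mul]; rfl) hcard

theorem nonempty_units_mulEquiv_C {K : Type*} [Field K] [Finite K] {n : ℕ} (h : Nat.card K = n) :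
    Nonempty (Kˣ ≃* C (n - 1)) := by
  have hn : 1 < n := h ▸ Finite.one_lt_card
  have : NeZero (n - 1) := ⟨by omega⟩
  exact ⟨mulEquivOfCyclicCardEq (by
    rw [Nat.card_units, h, Nat.card_eq_fintype_card, Fintype.card_multiplicative, ZMod.card])⟩

/-! ### Bookkeeping of direct powers -/

/-- Units of a direct power. -/
def unitsDirPow (M : Type*) [Monoid M] (n : ℕ) : (DirPow M n)ˣ ≃* DirPow Mˣ n :=
  MulEquiv.piUnits

/-- `X^m × X^n ≅ X^(m+n)` for algebras. -/
def dirPowAdd (F X : Type*) [CommSemiring F] [Semiring X] [Algebra F X] (m n : ℕ) :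
    (DirPow X m × DirPow X n) ≃ₐ[F] DirPow X (m + n) :=
  (AlgEquiv.sumArrowEquivProdArrow (Fin m) (Fin n) F X).symm.trans
    (AlgEquiv.piCongrLeft F (fun _ => X) finSumFinEquiv)

/-- `X ≅ X^1` for algebras. -/
def dirPowOne (F X : Type*) [CommSemiring F] [Semiring X] [Algebra F X] : X ≃ₐ[F] DirPow X 1 :=
  (AlgEquiv.funUnique F (Fin 1) X).symm

/-- Associativity of products of algebras. -/
def algProdAssoc (F X Y Z : Type*) [CommSemiring F] [Semiring X] [Semiring Y] [Semiring Z]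
    [Algebra F X] [Algebra F Y] [Algebra F Z] : ((X × Y) × Z) ≃ₐ[F] X × Y × Z where
  toEquiv := Equiv.prodAssoc X Y Z
  map_mul' _ _ := rfl
  map_add' _ _ := rfl
  commutes' _ := rfl

/-- A congruence for direct powers of groups. -/
def dirPowCongr {X Y : Type*} [Group X] [Group Y] (e : X ≃* Y) (n : ℕ) :
    DirPow X n ≃* DirPow Y n :=
  MulEquiv.piCongrRight fun _ => e

/-! ### Quadratic algebras -/

/-- The quadratic algebra of a polynomial with roots `α` and `β`, whose difference is a unit, is
split. -/
theorem nonempty_quadraticAlgebra_split {R : Type*} [CommRing R] {a b : R} (α β : R)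
    (ha : a = -(α * β)) (hb : b = α + β) (hu : IsUnit (α - β)) :
    Nonempty (QuadraticAlgebra R a b ≃ₐ[R] R × R) := by
  let f : QuadraticAlgebra R a b →ₐ[R] R × R := QuadraticAlgebra.lift ⟨(α, β), by
    ext <;> simp [ha, hb] <;> ring⟩
  have hf : ∀ z, f z = (z.re + z.im * α, z.re + z.im * β) := fun z => by
    ext <;> simp [f]
  obtain ⟨u, hu⟩ := hu
  have hui : (↑u⁻¹ : R) * (α - β) = 1 := by rw [← hu]; simp
  refine ⟨AlgEquiv.ofBijective f ⟨?_, ?_⟩⟩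
  · rw [injective_iff_map_eq_zero]
    intro z hz
    rw [hf, Prod.mk_eq_zero] at hz
    have him : z.im = 0 := by
      linear_combination (-z.im) * hui + (↑u⁻¹ : R) * hz.1 - (↑u⁻¹ : R) * hz.2
    ext
    · simpa [him] using hz.1
    · exact him
  · rintro ⟨x, y⟩
    refine ⟨⟨x - ↑u⁻¹ * (x - y) * α, ↑u⁻¹ * (x - y)⟩, ?_⟩
    rw [hf]
    ext
    · simp
    · simp only
      linear_combination (-(x - y)) * hui

/-- The formation of quadratic algebras commutes with binary products. -/
def quadraticAlgebraProd (F S T : Type*) [CommRing F] [CommRing S] [CommRing T] [Algebra F S]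
    [Algebra F T] (a b : S × T) :
    QuadraticAlgebra (S × T) a b ≃ₐ[F] QuadraticAlgebra S a.1 b.1 × QuadraticAlgebra T a.2 b.2 where
  toFun z := (⟨z.re.1, z.im.1⟩, ⟨z.re.2, z.im.2⟩)
  invFun w := ⟨(w.1.re, w.2.re), (w.1.im, w.2.im)⟩
  left_inv z := rfl
  right_inv w := rfl
  map_mul' z w := by ext <;> simp
  map_add' z w := by ext <;> simp
  commutes' r := rfl

/-- The quadratic algebra of a polynomial with a root in a quadratic field extension `E`, but not in
the ground field, is `E`. -/
theorem nonempty_quadraticAlgebra_field {K E : Type*} [Field K] [Field E] [Algebra K E]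
    (hE : Module.finrank K E = 2) {a b : K} (x : E)
    (hx : x * x = algebraMap K E a + algebraMap K E b * x) (hn : ∀ y : K, y * y ≠ a + b * y) :
    Nonempty (QuadraticAlgebra K a b ≃ₐ[K] E) := by
  have : Module.Finite K E := Module.finite_of_finrank_pos (by omega)
  let f : QuadraticAlgebra K a b →ₐ[K] E := QuadraticAlgebra.lift ⟨x, by
    rw [hx, Algebra.smul_def, Algebra.smul_def, mul_one]⟩
  have _ : Fact (∀ r, r ^ 2 ≠ a + b * r) := ⟨fun r => by rw [pow_two]; exact hn r⟩
  have hinj : Function.Injective f := f.toRingHom.injective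
  refine ⟨AlgEquiv.ofBijective f ⟨hinj, ?_⟩⟩
  refine (LinearMap.injective_iff_surjective_of_finrank_eq_finrank (f := f.toLinearMap) ?_).1 hinj
  rw [hE, QuadraticAlgebra.finrank_eq_two]

/-! ### Injective homomorphisms between finite algebras -/

theorem nonempty_algEquiv_of_injective {R A B : Type*} [CommSemiring R] [Semiring A] [Semiring B]
    [Algebra R A] [Algebra R B] [Finite B] (f : A →ₐ[R] B) (hf : Function.Injective f)
    (h : Nat.card B ≤ Nat.card A) : Nonempty (A ≃ₐ[R] B) :=
  ⟨AlgEquiv.ofBijective f (hf.bijective_of_nat_card_le h)⟩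

theorem natCard_monoidAlgebra (R M : Type*) [Semiring R] [Fintype M] :
    Nat.card (MonoidAlgebra R M) = Nat.card R ^ Fintype.card M := by
  rw [Nat.card_congr (MonoidAlgebra.coeffEquiv.trans Finsupp.equivFunOnFinite), Nat.card_fun,
    Nat.card_eq_fintype_card (α := M)]

theorem natCard_quadraticAlgebra (R : Type*) (a b : R) :
    Nat.card (QuadraticAlgebra R a b) = Nat.card R ^ 2 := by
  rw [Nat.card_congr (QuadraticAlgebra.equivProd a b), Nat.card_prod, pow_two]

instance (R : Type*) [Finite R] (a b : R) : Finite (QuadraticAlgebra R a b) :=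
  Finite.of_equiv _ (QuadraticAlgebra.equivProd a b).symm

/-! ### Roots of the two quadratic polynomials over finite fields -/

/-- In an extension of finite fields, the ground field consists of the fixed points of
Frobenius. -/
theorem mem_range_algebraMap_of_pow_card_eq {K E : Type*} [Field K] [Fintype K] [Field E] [Finite E]
    [Algebra K E] {x : E} (hx : x ^ Fintype.card K = x) : x ∈ Set.range (algebraMap K E) := by
  rw [IsGalois.mem_range_algebraMap_iff_fixed]
  intro f
  obtain ⟨n, rfl⟩ := (FiniteField.bijective_frobeniusAlgEquivOfAlgebraic_pow K E).2 f
  simp only [AlgEquiv.coe_pow, FiniteField.coe_frobeniusAlgEquivOfAlgebraic]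
  exact Function.iterate_fixed hx _

theorem exists_pow_eq_one_of_dvd {K : Type*} [Field K] [Finite K] {r : ℕ} [Fact r.Prime]
    (h : r ∣ Nat.card K - 1) : ∃ x : K, x ^ r = 1 ∧ x ≠ 1 := by
  rw [← Nat.card_units] at h
  obtain ⟨x, hx⟩ := exists_prime_orderOf_dvd_card' (G := Kˣ) r h
  refine ⟨x, ?_, ?_⟩
  · rw [← Units.val_pow_eq_pow_val, ← hx, pow_orderOf_eq_one, Units.val_one]
  · intro h1
    rw [Units.val_eq_one] at h1
    rw [h1, orderOf_one] at hx
    exact (Fact.out : r.Prime).one_lt.ne hx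

theorem exists_root_cyclotomic_three {K : Type*} [Field K] [Finite K] (h : Nat.card K % 3 = 1) :
    ∃ x : K, x * x = -1 + -1 * x := by
  have : Fact (Nat.Prime 3) := ⟨Nat.prime_three⟩
  obtain ⟨x, hx, hx1⟩ := exists_pow_eq_one_of_dvd (K := K) (r := 3) (by omega)
  refine ⟨x, mul_left_cancel₀ (sub_ne_zero.2 hx1) ?_⟩
  linear_combination hx

/-- A root of `X² + X + 1` is a cube root of unity, so Frobenius of a field with `q = 2` modulo `3`
squares it; it would be `1`, which is a root only in characteristic three. -/
theorem ne_root_cyclotomic_three {K : Type*} [Field K] [Finite K] (h : Nat.card K % 3 = 2) (y : K) :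
    y * y ≠ -1 + -1 * y := by
  intro hy
  have hq := Finite.one_lt_card (α := K)
  have h3 : y ^ 3 = 1 := by linear_combination (y - 1) * hy
  have hy0 : y ≠ 0 := by rintro rfl; simp at h3
  -- as `q = 2` modulo three, `y = y ^ q = y ^ 2`
  have hc : y ^ Nat.card K = y := by
    have := Fintype.ofFinite K
    rw [Nat.card_eq_fintype_card, FiniteField.pow_card]
  have hm : Nat.card K = 3 * (Nat.card K / 3) + 2 := by omega
  rw [hm, pow_add, pow_mul, h3, one_pow, one_mul] at hc
  have hy1 : y = 1 := mul_left_cancel₀ hy0 (by linear_combination hc)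
  subst hy1
  have h30 : (3 : K) = 0 := by linear_combination hy
  -- characteristic three is excluded by the cardinality
  have hd : ringChar K ∣ 3 := ringChar.dvd (by exact_mod_cast h30)
  have := Fintype.ofFinite K
  obtain ⟨n, hp, hn⟩ := FiniteField.card K (ringChar K)
  rw [(Nat.prime_dvd_prime_iff_eq hp Nat.prime_three).1 hd, ← Nat.card_eq_fintype_card] at hn
  rw [hn, ← Nat.succ_pred_eq_of_pos n.pos, pow_succ, Nat.mul_mod_left] at h
  omega

/-- If `q = ±1` modulo `5`, then `c = ζ + ζ⁻¹`, for a fifth root of unity `ζ` in the quadratic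
extension, is fixed by Frobenius. -/
theorem exists_root_golden {K : Type*} [Field K] [Finite K]
    (h : Nat.card K % 5 = 1 ∨ Nat.card K % 5 = 4) : ∃ x : K, x * x = 1 + -1 * x := by
  have : Fact (Nat.Prime 5) := ⟨Nat.prime_five⟩
  have : Fintype K := Fintype.ofFinite K
  obtain ⟨p, hp⟩ := CharP.exists K
  have : Fact p.Prime := ⟨CharP.char_is_prime K p⟩
  let E := FiniteField.Extension K p 2
  have hq := Finite.one_lt_card (α := K)
  have h5 : 5 ∣ Nat.card E - 1 := by
    rw [FiniteField.natCard_extension, ← Nat.modEq_iff_dvd' (Nat.one_le_pow _ _ (by omega))]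
    rcases h with h | h <;> rw [Nat.ModEq, Nat.pow_mod _ 2 5, h]
  obtain ⟨z, hz, hz1⟩ := exists_pow_eq_one_of_dvd h5
  have hz4 : z ^ 4 + z ^ 3 + z ^ 2 + z + 1 = 0 :=
    mul_left_cancel₀ (sub_ne_zero.2 hz1) (by linear_combination hz)
  have hfix : (z + z ^ 4) ^ Fintype.card K = z + z ^ 4 := by
    have hadd := map_add (FiniteField.frobeniusAlgHom K E) z (z ^ 4)
    simp only [FiniteField.coe_frobeniusAlgHom] at hadd
    rw [hadd, ← Nat.card_eq_fintype_card, ← Nat.div_add_mod (Nat.card K) 5]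
    rcases h with h | h <;> rw [h]
    · rw [pow_add, pow_add, pow_mul, pow_mul, hz, ← pow_mul z 4 5, mul_comm 4 5, pow_mul z 5 4, hz]
      simp
    · rw [pow_add, pow_add, pow_mul, pow_mul, hz, ← pow_mul z 4 5, mul_comm 4 5, pow_mul z 5 4, hz,
        one_pow, one_pow, one_pow, one_mul, one_mul]
      linear_combination (z ^ 11 + z ^ 6 + z) * hz
  obtain ⟨c, hc⟩ := mem_range_algebraMap_of_pow_card_eq hfix
  refine ⟨c, (algebraMap K E).injective ?_⟩
  simp only [map_mul, map_add, map_neg, map_one, hc]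
  linear_combination hz4 + (z ^ 3 + 2) * hz

section

/-! The powers of the matrix with characteristic polynomial `X² - c X + 1`, where `c² + c = 1`. -/

variable {A : Type*} [CommRing A] {c : A}

theorem golden_pow_two (hc : c * c = 1 - c) :
    (!![0, -1; 1, c] : M2 A) ^ 2 = !![-1, -c; c, -c] := by
  rw [pow_two, Matrix.mul_fin_two]
  ext i j
  fin_cases i <;> fin_cases j <;> simp
  linear_combination hc

theorem golden_pow_three (hc : c * c = 1 - c) :
    (!![0, -1; 1, c] : M2 A) ^ 3 = !![-c, c; -c, -1] := by
  rw [pow_succ, golden_pow_two hc, Matrix.mul_fin_two]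
  ext i j
  fin_cases i <;> fin_cases j <;> simp
  · linear_combination (-1 : A) * hc
  · linear_combination (-1 : A) * hc

theorem golden_pow_four (hc : c * c = 1 - c) :
    (!![0, -1; 1, c] : M2 A) ^ 4 = !![c, 1; -1, 0] := by
  rw [pow_succ, golden_pow_three hc, Matrix.mul_fin_two]
  ext i j
  fin_cases i <;> fin_cases j <;> simp
  linear_combination hc

theorem golden_pow_five (hc : c * c = 1 - c) : (!![0, -1; 1, c] : M2 A) ^ 5 = 1 := by
  rw [pow_succ, golden_pow_four hc, Matrix.mul_fin_two]
  ext i j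
  fin_cases i <;> fin_cases j <;> simp

end

/-- A root of `X² + X - 1` gives a matrix of order five in `GL(2, q)`, and `5` divides the order
of this group only if `q = 0, ±1` modulo `5`. -/
theorem ne_root_golden {K : Type*} [Field K] [Finite K]
    (h : Nat.card K % 5 = 2 ∨ Nat.card K % 5 = 3) (y : K) : y * y ≠ 1 + -1 * y := by
  intro hy
  have : Fact (Nat.Prime 5) := ⟨Nat.prime_five⟩
  have : Fintype K := Fintype.ofFinite K
  have hq := Finite.one_lt_card (α := K)
  let g : Matrix (Fin 2) (Fin 2) K := !![0, -1; 1, y]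
  have hg5 : g ^ 5 = 1 := golden_pow_five (by linear_combination hy)
  let u : Matrix.GeneralLinearGroup (Fin 2) K := Units.ofPowEqOne g 5 hg5 (by norm_num)
  have hu : orderOf u = 5 := by
    refine orderOf_eq_prime ?_ ?_
    · exact Units.ext hg5
    · intro h1
      have h2 : g = 1 := congrArg Units.val h1
      simpa [g] using congrFun (congrFun h2 1) 0
  have hd : 5 ∣ Nat.card (Matrix.GeneralLinearGroup (Fin 2) K) := hu ▸ orderOf_dvd_natCard u
  rw [Matrix.card_GL_field, Fin.prod_univ_two, ← Nat.card_eq_fintype_card,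
    Nat.prime_five.dvd_mul] at hd
  simp only [Fin.val_zero, Fin.val_one, pow_zero, pow_one] at hd
  rw [← Nat.modEq_iff_dvd' (Nat.one_le_pow _ _ (by omega)),
    ← Nat.modEq_iff_dvd' (Nat.le_self_pow two_ne_zero _)] at hd
  rw [Nat.ModEq, Nat.ModEq, Nat.pow_mod _ 2 5] at hd
  rcases h with h | h <;> rw [h] at hd <;> simp at hd

/-! ### Group algebras of cyclic and dihedral groups -/

theorem pow_val_add {A : Type*} [Monoid A] {n : ℕ} [NeZero n] {g : A} (hg : g ^ n = 1)
    (i j : ZMod n) : g ^ (i + j).val = g ^ i.val * g ^ j.val := by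
  rw [ZMod.val_add, ← pow_add, ← pow_eq_pow_mod _ hg]

/-- The homomorphism from the cyclic group `C_n` determined by an element `g` with `g ^ n = 1`. -/
def cyclicLift {A : Type*} [Monoid A] {n : ℕ} [NeZero n] (g : A) (hg : g ^ n = 1) : C n →* A where
  toFun x := g ^ x.toAdd.val
  map_one' := by simp
  map_mul' x y := pow_val_add hg _ _

/-- The homomorphism from the dihedral group of order `2n` determined by the image `g` of the
generating rotation and the image `s` of a reflection. -/
def dihedralLift {A : Type*} [Monoid A] {n : ℕ} [NeZero n] (g s : A) (hg : g ^ n = 1)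
    (hs : s * s = 1) (hgs : g * s * g = s) : DihedralGroup n →* A where
  toFun x := match x with
    | .r i => g ^ i.val
    | .sr i => s * g ^ i.val
  map_one' := by simp [DihedralGroup.one_def, -DihedralGroup.r_zero]
  map_mul' := by
    have hk (k : ℕ) : g ^ k * s * g ^ k = s := by
      induction k with
      | zero => simp
      | succ k ih =>
        calc g ^ (k + 1) * s * g ^ (k + 1) = g ^ k * (g * s * g) * g ^ k := by
              rw [pow_succ]
              nth_rw 2 [← pow_succ]
              rw [pow_succ']
              simp only [mul_assoc]
          _ = s := by rw [hgs, ih]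
    have hij (i j : ZMod n) : g ^ i.val * s * g ^ j.val = s * g ^ (j - i).val := by
      conv_lhs => rw [← add_sub_cancel i j, pow_val_add hg, ← mul_assoc, hk]
    rintro (i | i) (j | j)
    · exact pow_val_add hg i j
    · change _ = g ^ i.val * (s * g ^ j.val)
      rw [← mul_assoc, hij]; rfl
    · change _ = s * g ^ i.val * g ^ j.val
      rw [mul_assoc, ← pow_val_add hg]; rfl
    · change _ = s * g ^ i.val * (s * g ^ j.val)
      rw [mul_assoc, ← mul_assoc (g ^ i.val), hij, ← mul_assoc, hs, one_mul]; rfl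

theorem lift_apply_dihedralGroup_five {R A : Type*} [CommSemiring R] [Semiring A] [Algebra R A]
    (φ : DihedralGroup 5 →* A) (x : MonoidAlgebra R (DihedralGroup 5)) :
    MonoidAlgebra.lift R A (DihedralGroup 5) φ x =
      ∑ i : Fin 5, x.coeff (.r i) • φ (.r i) + ∑ i : Fin 5, x.coeff (.sr i) • φ (.sr i) := by
  rw [MonoidAlgebra.lift_apply, Finsupp.sum_fintype _ _ (by simp),
    ← DihedralGroup.equivSum.symm.sum_comp, Fintype.sum_sum_type]
  rfl

theorem monoidAlgebra_dihedralGroup_eq_zero {R : Type*} [Semiring R] {n : ℕ}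
    {x : MonoidAlgebra R (DihedralGroup n)} (hr : ∀ i, x.coeff (.r i) = 0)
    (hs : ∀ i, x.coeff (.sr i) = 0) : x = 0 := by
  ext g
  cases g with
  | r i => exact hr i
  | sr i => exact hs i

theorem lift_apply_C {R A : Type*} [CommSemiring R] [Semiring A] [Algebra R A] {n : ℕ}
    [NeZero n] (φ : C n →* A) (x : MonoidAlgebra R (C n)) :
    MonoidAlgebra.lift R A (C n) φ x =
      ∑ i : ZMod n, x.coeff (.ofAdd i) • φ (.ofAdd i) := by
  rw [MonoidAlgebra.lift_apply, Finsupp.sum_fintype _ _ (by simp),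
    ← Multiplicative.ofAdd.sum_comp]

/-- If `3` is invertible in `R`, then `R[C₃] = R × R[ω]` with `ω² + ω + 1 = 0`. -/
theorem nonempty_monoidAlgebra_C_three {R : Type*} [CommRing R] [Finite R] (h3 : IsUnit (3 : R)) :
    Nonempty (MonoidAlgebra R (C 3) ≃ₐ[R] R × QuadraticAlgebra R (-1) (-1)) := by
  let g : R × QuadraticAlgebra R (-1) (-1) := (1, ⟨0, 1⟩)
  have hg : g ^ 3 = 1 := by ext <;> simp [g, pow_succ]
  refine nonempty_algEquiv_of_injective (MonoidAlgebra.lift R _ (C 3) (cyclicLift g hg)) ?_ ?_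
  · rw [injective_iff_map_eq_zero]
    intro x hx
    rw [lift_apply_C] at hx
    change ∑ i : Fin 3, x.coeff (.ofAdd i) • g ^ ((i : Fin 3) : ℕ) = 0 at hx
    simp [Fin.sum_univ_three, g, pow_two, QuadraticAlgebra.ext_iff] at hx
    obtain ⟨h0, h1, h2⟩ := hx
    have hz2 : x.coeff (.ofAdd 2) = 0 := h3.mul_left_cancel (by linear_combination h0 - h1 - h2)
    have hz1 : x.coeff (.ofAdd 1) = 0 := by linear_combination h2 + hz2
    have hz0 : x.coeff (.ofAdd 0) = 0 := by linear_combination h1 + hz2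
    ext i
    fin_cases i
    exacts [hz0, hz1, hz2]
  · rw [natCard_monoidAlgebra, Nat.card_prod, natCard_quadraticAlgebra, Fintype.card_multiplicative,
      ZMod.card, ← pow_succ']

/-- `R[C₂] = R[g]` with `g² = 1`. -/
theorem nonempty_monoidAlgebra_C_two {R : Type*} [CommRing R] [Finite R] :
    Nonempty (MonoidAlgebra R (C 2) ≃ₐ[R] QuadraticAlgebra R 1 0) := by
  let g : QuadraticAlgebra R 1 0 := ⟨0, 1⟩
  have hg : g ^ 2 = 1 := by ext <;> simp [g, pow_succ]
  refine nonempty_algEquiv_of_injective (MonoidAlgebra.lift R _ (C 2) (cyclicLift g hg)) ?_ ?_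
  · rw [injective_iff_map_eq_zero]
    intro x hx
    rw [lift_apply_C] at hx
    change ∑ i : Fin 2, x.coeff (.ofAdd i) • g ^ ((i : Fin 2) : ℕ) = 0 at hx
    simp [Fin.sum_univ_two, g, QuadraticAlgebra.ext_iff] at hx
    ext i
    fin_cases i
    exacts [hx.1, hx.2]
  · rw [natCard_monoidAlgebra, natCard_quadraticAlgebra, Fintype.card_multiplicative, ZMod.card]

/-- If `5` is invertible in `R`, then `R[D₁₀] = R[C₂] × M₂(R[c])` with `c² + c = 1`; here `c` is the
trace of the generating rotation in the two-dimensional representations. -/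
theorem nonempty_monoidAlgebra_dihedralGroup_five {R : Type*} [CommRing R] [Finite R]
    (h5 : IsUnit (5 : R)) :
    Nonempty (MonoidAlgebra R (DihedralGroup 5) ≃ₐ[R]
      QuadraticAlgebra R 1 0 × M2 (QuadraticAlgebra R 1 (-1))) := by
  let c : QuadraticAlgebra R 1 (-1) := ⟨0, 1⟩
  have hc : c * c = 1 - c := by ext <;> simp [c]
  let g : QuadraticAlgebra R 1 0 × M2 (QuadraticAlgebra R 1 (-1)) := (1, !![0, -1; 1, c])
  let s : QuadraticAlgebra R 1 0 × M2 (QuadraticAlgebra R 1 (-1)) := (⟨0, 1⟩, !![0, 1; 1, 0])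
  have hg : g ^ 5 = 1 := Prod.ext (one_pow 5) (golden_pow_five hc)
  have hs : s * s = 1 := by
    refine Prod.ext (by ext <;> simp [s]) ?_
    simp [s, Matrix.one_fin_two]
  have hgs : g * s * g = s := by
    refine Prod.ext (by simp [g, s]) ?_
    simp [g, s]
  refine nonempty_algEquiv_of_injective
    (MonoidAlgebra.lift R _ (DihedralGroup 5) (dihedralLift g s hg hs hgs)) ?_ ?_
  · rw [injective_iff_map_eq_zero]
    intro x hx
    rw [lift_apply_dihedralGroup_five] at hx
    change ∑ i : Fin 5, x.coeff (.r i) • g ^ (i : ℕ) +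
      ∑ i : Fin 5, x.coeff (.sr i) • (s * g ^ (i : ℕ)) = 0 at hx
    simp only [Fin.sum_univ_five] at hx
    have h1 := congrArg Prod.fst hx
    have h2 := congrArg Prod.snd hx
    simp only [Prod.fst_add, Prod.smul_fst, Prod.fst_mul, Prod.pow_fst, g, s] at h1
    simp only [Prod.snd_add, Prod.smul_snd, Prod.snd_mul, Prod.pow_snd, g, s] at h2
    simp [QuadraticAlgebra.ext_iff] at h1
    simp [golden_pow_two hc, golden_pow_three hc, golden_pow_four hc, Matrix.one_fin_two] at h2
    -- the components of the matrix entries on the basis `1, c`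
    have h00 := QuadraticAlgebra.ext_iff.1 (congrFun (congrFun h2 0) 0)
    have h01 := QuadraticAlgebra.ext_iff.1 (congrFun (congrFun h2 0) 1)
    have h10 := QuadraticAlgebra.ext_iff.1 (congrFun (congrFun h2 1) 0)
    have h11 := QuadraticAlgebra.ext_iff.1 (congrFun (congrFun h2 1) 1)
    simp [c] at h00 h01 h10 h11
    -- ten linear equations for the ten coefficients: the inverse of their matrix becomes integral
    -- when multiplied by five, and its rows are the multipliers below
    have z0 : x.coeff (.r 0) = 0 := h5.mul_left_cancel (by
      linear_combination h1.1 + 2 * h00.1 - h00.2 + 2 * h11.1 - h11.2)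
    have z1 : x.coeff (.r 1) = 0 := h5.mul_left_cancel (by
      linear_combination h1.1 - h00.1 + 3 * h00.2 - 2 * h01.1 + h01.2 + 2 * h10.1 - h10.2)
    have z2 : x.coeff (.r 2) = 0 := h5.mul_left_cancel (by
      linear_combination h1.1 + h00.1 - 3 * h00.2 + h01.1 - 3 * h01.2 - h10.1 + 3 * h10.2 -
        2 * h11.1 + h11.2)
    have z3 : x.coeff (.r 3) = 0 := h5.mul_left_cancel (by
      linear_combination h1.1 - 2 * h00.1 + h00.2 - h01.1 + 3 * h01.2 + h10.1 - 3 * h10.2 +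
        h11.1 - 3 * h11.2)
    have z4 : x.coeff (.r 4) = 0 := h5.mul_left_cancel (by
      linear_combination h1.1 + 2 * h01.1 - h01.2 - 2 * h10.1 + h10.2 - h11.1 + 3 * h11.2)
    have z5 : x.coeff (.sr 0) = 0 := h5.mul_left_cancel (by
      linear_combination h1.2 + 2 * h01.1 - h01.2 + 2 * h10.1 - h10.2)
    have z6 : x.coeff (.sr 1) = 0 := h5.mul_left_cancel (by
      linear_combination h1.2 + 2 * h00.1 - h00.2 - h10.1 + 3 * h10.2 - 2 * h11.1 + h11.2)
    have z7 : x.coeff (.sr 2) = 0 := h5.mul_left_cancel (by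
      linear_combination h1.2 - h00.1 + 3 * h00.2 - 2 * h01.1 + h01.2 + h10.1 - 3 * h10.2 +
        h11.1 - 3 * h11.2)
    have z8 : x.coeff (.sr 3) = 0 := h5.mul_left_cancel (by
      linear_combination h1.2 + h00.1 - 3 * h00.2 + h01.1 - 3 * h01.2 - 2 * h10.1 + h10.2 -
        h11.1 + 3 * h11.2)
    have z9 : x.coeff (.sr 4) = 0 := h5.mul_left_cancel (by
      linear_combination h1.2 - 2 * h00.1 + h00.2 - h01.1 + 3 * h01.2 + 2 * h11.1 - h11.2)
    refine monoidAlgebra_dihedralGroup_eq_zero (fun i => ?_) fun i => ?_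
    · fin_cases i
      exacts [z0, z1, z2, z3, z4]
    · fin_cases i
      exacts [z5, z6, z7, z8, z9]
  · rw [natCard_monoidAlgebra, Nat.card_prod, natCard_quadraticAlgebra,
      Nat.card_congr (Matrix.of (m := Fin 2) (n := Fin 2) (α := QuadraticAlgebra R 1 (-1))).symm,
      Nat.card_fun, Nat.card_fun,
      natCard_quadraticAlgebra, DihedralGroup.card, Nat.card_fin, ← pow_mul, ← pow_mul, ← pow_add]

/-! ### Products of matrix and quadratic algebras -/

section Products

variable (F : Type*) [CommRing F]

/-- Matrices over a direct power. -/
def matrixDirPow (S : Type*) [CommRing S] [Algebra F S] (n : ℕ) :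
    M2 (DirPow S n) ≃ₐ[F] DirPow (M2 S) n where
  toFun A k := Matrix.of fun i j => A i j k
  invFun B := Matrix.of fun i j k => B k i j
  left_inv A := rfl
  right_inv B := rfl
  map_mul' A B := by
    ext k i j
    simp [Matrix.mul_apply]
  map_add' A B := rfl
  commutes' r := by
    ext k i j
    simp only [Matrix.of_apply, Matrix.algebraMap_matrix_apply, Pi.algebraMap_apply]
    split_ifs <;> rfl

/-- Matrices over a product. -/
def matrixProd (S T : Type*) [CommRing S] [CommRing T] [Algebra F S] [Algebra F T] :
    M2 (S × T) ≃ₐ[F] M2 S × M2 T where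
  toFun A := (Matrix.of fun i j => (A i j).1, Matrix.of fun i j => (A i j).2)
  invFun B := Matrix.of fun i j => (B.1 i j, B.2 i j)
  left_inv A := rfl
  right_inv B := rfl
  map_mul' A B := by
    ext i j <;> simp [Matrix.mul_apply]
  map_add' A B := rfl
  commutes' r := by
    ext i j <;>
    · simp only [Matrix.of_apply, Matrix.algebraMap_matrix_apply, Prod.algebraMap_apply]
      split_ifs <;> rfl

/-- The formation of quadratic algebras commutes with direct powers. -/
def quadraticAlgebraDirPow (S : Type*) [CommRing S] [Algebra F S] (n : ℕ) (a b : DirPow S n) :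
    QuadraticAlgebra (DirPow S n) a b ≃ₐ[F] ∀ i, QuadraticAlgebra S (a i) (b i) where
  toFun z i := ⟨z.re i, z.im i⟩
  invFun w := ⟨fun i => (w i).re, fun i => (w i).im⟩
  left_inv z := rfl
  right_inv w := rfl
  map_mul' z w := by ext <;> simp
  map_add' z w := by ext <;> simp
  commutes' r := rfl

end Products

/-! ### The rings `F[C₃]` and `F[C₃][c]`, where `c² + c = 1` -/

section Structure

variable {F : Type*} [Field F]

/-- The group algebra of `C₃ × D₁₀` is the group algebra of `D₁₀` over that of `C₃`. -/
theorem nonempty_algEquiv_dihedral {R : Type*} [CommRing R] [Algebra F R]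
    (e : MonoidAlgebra F (C 3) ≃ₐ[F] R) :
    Nonempty (MonoidAlgebra F G ≃ₐ[F] MonoidAlgebra R (DihedralGroup 5)) :=
  ⟨(MonoidAlgebra.domCongr F F MulEquiv.prodComm).trans
    ((MonoidAlgebra.curryAlgEquiv F).trans (MonoidAlgebra.mapAlgEquiv F _ e))⟩

variable {p : ℕ} [Fact p.Prime] [CharP F p]

theorem isUnit_natCast_of_ne {r : ℕ} (hr : r.Prime)
    (h : p ≠ r) (R : Type*) [CommRing R] [Algebra F R] : IsUnit (r : R) := by
  have h1 : (r : F) ≠ 0 := fun h0 =>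
    h ((Nat.prime_dvd_prime_iff_eq Fact.out hr).1 ((CharP.cast_eq_zero_iff F p r).1 h0))
  simpa using (isUnit_iff_ne_zero.2 h1).map (algebraMap F R)

theorem nonempty_algEquiv_matrix (hp : p ≠ 5) {R : Type*} [CommRing R] [Finite R] [Algebra F R]
    (e : MonoidAlgebra F (C 3) ≃ₐ[F] R) {B : Type*} [CommRing B] [Algebra F B]
    (e' : QuadraticAlgebra R 1 (-1) ≃ₐ[F] B) :
    Nonempty (MonoidAlgebra F G ≃ₐ[F] QuadraticAlgebra R 1 0 × M2 B) := by
  obtain ⟨e₁⟩ := nonempty_algEquiv_dihedral e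
  obtain ⟨e₂⟩ := nonempty_monoidAlgebra_dihedralGroup_five (R := R)
    (isUnit_natCast_of_ne (p := p) (F := F) Nat.prime_five hp R)
  exact ⟨e₁.trans ((e₂.restrictScalars F).trans (AlgEquiv.prodCongr .refl e'.mapMatrix))⟩

theorem nonempty_quadraticAlgebra_one_zero (hp : p ≠ 2) (R : Type*) [CommRing R] [Algebra F R] :
    Nonempty (QuadraticAlgebra R 1 0 ≃ₐ[F] R × R) := by
  have h2 : IsUnit (2 : R) := isUnit_natCast_of_ne (p := p) (F := F) Nat.prime_two hp R
  obtain ⟨e⟩ := nonempty_quadraticAlgebra_split (R := R) (a := 1) (b := 0) 1 (-1) (by ring)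
    (by ring) (by rwa [sub_neg_eq_add, one_add_one_eq_two])
  exact ⟨e.restrictScalars F⟩

/-- The ring `S[c]`, `c² + c = 1`, is split if it has a solution `x` in `S`. -/
theorem nonempty_golden_split (hp : p ≠ 5) {S : Type*} [CommRing S] [Algebra F S] {x : S}
    (hx : x * x = 1 + -1 * x) : Nonempty (QuadraticAlgebra S 1 (-1) ≃ₐ[F] S × S) := by
  have h5 : IsUnit (5 : S) := isUnit_natCast_of_ne (p := p) (F := F) Nat.prime_five hp S
  -- the difference `2x + 1` of the two roots is invertible since its square is `5`
  obtain ⟨e⟩ := nonempty_quadraticAlgebra_split (R := S) (a := 1) (b := -1) x (-1 - x)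
    (by linear_combination -hx) (by ring)
    (isUnit_of_mul_isUnit_left (y := 2 * x + 1) (by
      rw [show (x - (-1 - x)) * (2 * x + 1) = 5 by linear_combination 4 * hx]
      exact h5))
  exact ⟨e.restrictScalars F⟩

variable [Finite F]

variable (F p) in
theorem nonempty_algEquiv_C_three_of_mod_eq_one (hp : p ≠ 3) (h : Nat.card F % 3 = 1) :
    Nonempty (MonoidAlgebra F (C 3) ≃ₐ[F] DirPow F 3) := by
  have h3 : IsUnit (3 : F) := isUnit_natCast_of_ne (p := p) (F := F) Nat.prime_three hp F
  obtain ⟨e⟩ := nonempty_monoidAlgebra_C_three h3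
  obtain ⟨x, hx⟩ := exists_root_cyclotomic_three h
  -- the difference `2x + 1` of the two roots is invertible since its square is `-3`
  obtain ⟨e'⟩ := nonempty_quadraticAlgebra_split (R := F) (a := -1) (b := -1) x (-1 - x)
    (by linear_combination -hx) (by ring)
    (isUnit_of_mul_isUnit_left (y := 2 * x + 1) (by
      rw [show (x - (-1 - x)) * (2 * x + 1) = -3 by linear_combination 4 * hx]
      exact h3.neg))
  exact ⟨e.trans ((AlgEquiv.prodCongr (dirPowOne F F) (e'.trans ((AlgEquiv.prodCongr
    (dirPowOne F F) (dirPowOne F F)).trans (dirPowAdd F F 1 1)))).trans (dirPowAdd F F 1 2))⟩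

variable (F p) in
theorem nonempty_algEquiv_C_three_of_mod_eq_two (hp : p ≠ 3) (h : Nat.card F % 3 = 2) :
    Nonempty (MonoidAlgebra F (C 3) ≃ₐ[F] F × QuadExt F p) := by
  have h3 : IsUnit (3 : F) := isUnit_natCast_of_ne (p := p) (F := F) Nat.prime_three hp F
  obtain ⟨e⟩ := nonempty_monoidAlgebra_C_three h3
  obtain ⟨x, hx⟩ := exists_root_cyclotomic_three (K := QuadExt F p)
    (by rw [FiniteField.natCard_extension, Nat.pow_mod, h])
  obtain ⟨e'⟩ := nonempty_quadraticAlgebra_field (FiniteField.finrank_extension F p 2)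
    (a := -1) (b := -1) x (by simpa using hx) (ne_root_cyclotomic_three h)
  exact ⟨e.trans (AlgEquiv.prodCongr .refl e')⟩

variable (F p) in
theorem nonempty_golden_quadExt (h : Nat.card F % 5 = 2 ∨ Nat.card F % 5 = 3) :
    Nonempty (QuadraticAlgebra F 1 (-1) ≃ₐ[F] QuadExt F p) := by
  obtain ⟨x, hx⟩ := exists_root_golden (K := QuadExt F p) (by
    rw [FiniteField.natCard_extension, Nat.pow_mod]
    rcases h with h | h <;> simp only [h] <;> decide)
  exact nonempty_quadraticAlgebra_field (FiniteField.finrank_extension F p 2)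
    (a := 1) (b := -1) x (by simpa using hx) (ne_root_golden h)

theorem nonempty_golden_quadExt_split (hp : p ≠ 5) (h : Nat.card F % 5 ≠ 0) :
    Nonempty (QuadraticAlgebra (QuadExt F p) 1 (-1) ≃ₐ[F] QuadExt F p × QuadExt F p) := by
  obtain ⟨x, hx⟩ := exists_root_golden (K := QuadExt F p) (by
    rw [FiniteField.natCard_extension, Nat.pow_mod]
    have := Nat.mod_lt (Nat.card F) (show 5 > 0 by norm_num)
    interval_cases Nat.card F % 5 <;> simp at h ⊢)
  exact nonempty_golden_split hp hx

variable (F p) in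
theorem nonempty_prod_prod_quadExt : Nonempty (((F × QuadExt F p) × (F × QuadExt F p)) ≃ₐ[F]
    DirPow F 2 × DirPow (QuadExt F p) 2) := by
  have e₁ : (F × F) ≃ₐ[F] DirPow F 2 :=
    (AlgEquiv.prodCongr (dirPowOne F F) (dirPowOne F F)).trans (dirPowAdd F F 1 1)
  have e₂ : (QuadExt F p × QuadExt F p) ≃ₐ[F] DirPow (QuadExt F p) 2 :=
    (AlgEquiv.prodCongr (dirPowOne F _) (dirPowOne F _)).trans (dirPowAdd F _ 1 1)
  exact ⟨(AlgEquiv.ofRingEquiv (f := RingEquiv.prodProdProdComm _ _ _ _) fun _ => rfl).trans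
    (AlgEquiv.prodCongr e₁ e₂)⟩

variable (F p) in
theorem nonempty_golden_one_split (hp : p ≠ 5) (h : Nat.card F % 5 = 1 ∨ Nat.card F % 5 = 4) :
    Nonempty (QuadraticAlgebra (DirPow F 3) 1 (-1) ≃ₐ[F] DirPow F 6) := by
  obtain ⟨x, hx⟩ := exists_root_golden h
  obtain ⟨e⟩ := nonempty_golden_split (F := F) hp (S := DirPow F 3) (x := fun _ => x)
    (funext fun _ => hx)
  exact ⟨e.trans (dirPowAdd F F 3 3)⟩

variable (F p) in
theorem nonempty_golden_two_split (hp : p ≠ 5) (h : Nat.card F % 5 = 1 ∨ Nat.card F % 5 = 4) :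
    Nonempty (QuadraticAlgebra (F × QuadExt F p) 1 (-1) ≃ₐ[F]
      DirPow F 2 × DirPow (QuadExt F p) 2) := by
  obtain ⟨x, hx⟩ := exists_root_golden h
  have hx' := congrArg (algebraMap F (F × QuadExt F p)) hx
  simp only [map_mul, map_add, map_neg, map_one] at hx'
  obtain ⟨e⟩ := nonempty_golden_split (F := F) hp hx'
  obtain ⟨e'⟩ := nonempty_prod_prod_quadExt F p
  exact ⟨e.trans e'⟩

variable (F p) in
theorem nonempty_golden_one_inert (h : Nat.card F % 5 = 2 ∨ Nat.card F % 5 = 3) :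
    Nonempty (QuadraticAlgebra (DirPow F 3) 1 (-1) ≃ₐ[F] DirPow (QuadExt F p) 3) := by
  obtain ⟨e⟩ := nonempty_golden_quadExt F p h
  exact ⟨(quadraticAlgebraDirPow F F 3 1 (-1)).trans (AlgEquiv.piCongrRight fun _ => e)⟩

variable (F p) in
theorem nonempty_golden_two_inert (hp : p ≠ 5) (h : Nat.card F % 5 = 2 ∨ Nat.card F % 5 = 3) :
    Nonempty (QuadraticAlgebra (F × QuadExt F p) 1 (-1) ≃ₐ[F] DirPow (QuadExt F p) 3) := by
  obtain ⟨e⟩ := nonempty_golden_quadExt F p h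
  obtain ⟨e'⟩ := nonempty_golden_quadExt_split (F := F) hp (by omega)
  exact ⟨(quadraticAlgebraProd F F (QuadExt F p) 1 (-1)).trans ((AlgEquiv.prodCongr
    (e.trans (dirPowOne F _)) (e'.trans ((AlgEquiv.prodCongr (dirPowOne F _) (dirPowOne F _)).trans
      (dirPowAdd F _ 1 1)))).trans (dirPowAdd F _ 1 2))⟩

end Structure

/-! ### Units in characteristic two -/

/-- In characteristic two, `R[g]` with `g² = 1` has unit group `R × Rˣ`, where `b ∈ R` corresponds
to the unit `1 + b (1 + g)` of augmentation one. -/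
theorem nonempty_units_quadraticAlgebra_one_zero (R : Type*) [CommRing R] [CharP R 2] :
    Nonempty ((QuadraticAlgebra R 1 0)ˣ ≃* Multiplicative R × Rˣ) := by
  have h2 : (2 : R) = 0 := CharTwo.two_eq_zero
  let ε : QuadraticAlgebra R 1 0 →ₐ[R] R := QuadraticAlgebra.lift ⟨1, by simp⟩
  have hε (z) : ε z = z.re + z.im := by simp [ε]
  have hN (x y : R) :
      (⟨1 + x, x⟩ : QuadraticAlgebra R 1 0) * ⟨1 + y, y⟩ = ⟨1 + (x + y), x + y⟩ := by
    ext
    · simp; linear_combination x * y * h2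
    · simp; linear_combination x * y * h2
  let ν (x : R) : (QuadraticAlgebra R 1 0)ˣ := ⟨⟨1 + x, x⟩, ⟨1 + x, x⟩,
    by rw [hN, CharTwo.add_self_eq_zero, add_zero]; rfl,
    by rw [hN, CharTwo.add_self_eq_zero, add_zero]; rfl⟩
  let f : Multiplicative R × Rˣ →* (QuadraticAlgebra R 1 0)ˣ :=
    { toFun := fun w => ν w.1.toAdd * Units.map (algebraMap R _).toMonoidHom w.2
      map_one' := by ext <;> simp [ν]
      map_mul' := by
        rintro ⟨x, u⟩ ⟨y, v⟩
        have h : ν (x * y).toAdd = ν x.toAdd * ν y.toAdd := Units.ext (hN _ _).symm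
        simp only [Prod.mk_mul_mk, map_mul, h]
        exact mul_mul_mul_comm _ _ _ _ }
  have hf (x : R) (u : Rˣ) : (f (.ofAdd x, u)).val = ⟨(1 + x) * u, x * u⟩ := by
    ext <;> simp [f, ν, QuadraticAlgebra.algebraMap_re, QuadraticAlgebra.algebraMap_im]
  refine ⟨(MulEquiv.ofBijective f ⟨?_, fun w => ?_⟩).symm⟩
  · rw [injective_iff_map_eq_one]
    rintro ⟨x, u⟩ h
    have h' := congrArg Units.val h
    rw [← ofAdd_toAdd x, hf, QuadraticAlgebra.ext_iff] at h'
    obtain ⟨h3, h4⟩ := h'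
    have hx : x.toAdd = 0 := by simpa using h4
    refine Prod.ext hx (Units.ext ?_)
    simpa [hx] using h3
  · let v : Rˣ := Units.map ε.toRingHom.toMonoidHom w
    have hv : (v : R) = w.val.re + w.val.im := hε _
    refine ⟨(.ofAdd (v⁻¹ * w.val.im), v), Units.ext ?_⟩
    have hi : ((v⁻¹ : Rˣ) : R) * v = 1 := v.inv_mul
    rw [hf]
    ext
    · linear_combination hv + w.val.im * hi + w.val.im * h2
    · linear_combination w.val.im * hi

/-! ### The truncated algebra of the cyclic quiver with two vertices -/

/-- The algebra of matrices `[[a, y b], [y c, d]]` with `a, d ∈ R[t]/(t³)`, `b, c ∈ R[t]/(t²)` and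
`t = y²`, `y⁵ = 0`, given by the coefficients of `a`, `b`, `c` and `d`. It is the path algebra of
the cyclic quiver with two vertices, truncated at paths of length five. -/
@[ext]
structure CycAlg (R : Type*) where
  /-- The coefficient of `t ^ 0` in the upper left entry. -/
  a0 : R
  /-- The coefficient of `t ^ 1` in the upper left entry. -/
  a1 : R
  /-- The coefficient of `t ^ 2` in the upper left entry. -/
  a2 : R
  /-- The coefficient of `t ^ 0` in the upper right entry. -/
  b0 : R
  /-- The coefficient of `t ^ 1` in the upper right entry. -/
  b1 : R
  /-- The coefficient of `t ^ 0` in the lower left entry. -/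
  c0 : R
  /-- The coefficient of `t ^ 1` in the lower left entry. -/
  c1 : R
  /-- The coefficient of `t ^ 0` in the lower right entry. -/
  d0 : R
  /-- The coefficient of `t ^ 1` in the lower right entry. -/
  d1 : R
  /-- The coefficient of `t ^ 2` in the lower right entry. -/
  d2 : R

namespace CycAlg

/-- The coordinates of an element. -/
def equivProd (R : Type*) : CycAlg R ≃ (R × R × R × R × R) × (R × R × R × R × R) where
  toFun x := ((x.a0, x.a1, x.a2, x.b0, x.b1), (x.c0, x.c1, x.d0, x.d1, x.d2))
  invFun w := ⟨w.1.1, w.1.2.1, w.1.2.2.1, w.1.2.2.2.1, w.1.2.2.2.2,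
    w.2.1, w.2.2.1, w.2.2.2.1, w.2.2.2.2.1, w.2.2.2.2.2⟩
  left_inv _ := rfl
  right_inv _ := rfl

instance (R : Type*) [Finite R] : Finite (CycAlg R) := Finite.of_equiv _ (equivProd R).symm

theorem natCard (R : Type*) : Nat.card (CycAlg R) = Nat.card R ^ 10 := by
  rw [Nat.card_congr (equivProd R)]
  simp only [Nat.card_prod]
  ring

variable {R : Type*} [CommRing R]

instance : Zero (CycAlg R) := ⟨⟨0, 0, 0, 0, 0, 0, 0, 0, 0, 0⟩⟩

instance : One (CycAlg R) := ⟨⟨1, 0, 0, 0, 0, 0, 0, 1, 0, 0⟩⟩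

instance : Add (CycAlg R) :=
  ⟨fun x y => ⟨x.a0 + y.a0, x.a1 + y.a1, x.a2 + y.a2, x.b0 + y.b0, x.b1 + y.b1,
    x.c0 + y.c0, x.c1 + y.c1, x.d0 + y.d0, x.d1 + y.d1, x.d2 + y.d2⟩⟩

instance : Neg (CycAlg R) :=
  ⟨fun x => ⟨-x.a0, -x.a1, -x.a2, -x.b0, -x.b1, -x.c0, -x.c1, -x.d0, -x.d1, -x.d2⟩⟩

instance : Mul (CycAlg R) :=
  ⟨fun x y => ⟨x.a0 * y.a0,
    x.a0 * y.a1 + x.a1 * y.a0 + x.b0 * y.c0,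
    x.a0 * y.a2 + x.a1 * y.a1 + x.a2 * y.a0 + x.b0 * y.c1 + x.b1 * y.c0,
    x.a0 * y.b0 + x.b0 * y.d0,
    x.a0 * y.b1 + x.a1 * y.b0 + x.b0 * y.d1 + x.b1 * y.d0,
    x.c0 * y.a0 + x.d0 * y.c0,
    x.c0 * y.a1 + x.c1 * y.a0 + x.d0 * y.c1 + x.d1 * y.c0,
    x.d0 * y.d0,
    x.d0 * y.d1 + x.d1 * y.d0 + x.c0 * y.b0,
    x.d0 * y.d2 + x.d1 * y.d1 + x.d2 * y.d0 + x.c0 * y.b1 + x.c1 * y.b0⟩⟩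

@[simp] theorem a0_zero : (0 : CycAlg R).a0 = 0 := rfl
@[simp] theorem a0_one : (1 : CycAlg R).a0 = 1 := rfl
@[simp] theorem a0_add (x y : CycAlg R) : (x + y).a0 = x.a0 + y.a0 := rfl
@[simp] theorem a0_neg (x : CycAlg R) : (-x).a0 = -x.a0 := rfl
@[simp] theorem a0_mul (x y : CycAlg R) : (x * y).a0 =
    x.a0 * y.a0 := rfl
@[simp] theorem a1_zero : (0 : CycAlg R).a1 = 0 := rfl
@[simp] theorem a1_one : (1 : CycAlg R).a1 = 0 := rfl
@[simp] theorem a1_add (x y : CycAlg R) : (x + y).a1 = x.a1 + y.a1 := rfl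
@[simp] theorem a1_neg (x : CycAlg R) : (-x).a1 = -x.a1 := rfl
@[simp] theorem a1_mul (x y : CycAlg R) : (x * y).a1 =
    x.a0 * y.a1 + x.a1 * y.a0 + x.b0 * y.c0 := rfl
@[simp] theorem a2_zero : (0 : CycAlg R).a2 = 0 := rfl
@[simp] theorem a2_one : (1 : CycAlg R).a2 = 0 := rfl
@[simp] theorem a2_add (x y : CycAlg R) : (x + y).a2 = x.a2 + y.a2 := rfl
@[simp] theorem a2_neg (x : CycAlg R) : (-x).a2 = -x.a2 := rfl
@[simp] theorem a2_mul (x y : CycAlg R) : (x * y).a2 =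
    x.a0 * y.a2 + x.a1 * y.a1 + x.a2 * y.a0 + x.b0 * y.c1 + x.b1 * y.c0 := rfl
@[simp] theorem b0_zero : (0 : CycAlg R).b0 = 0 := rfl
@[simp] theorem b0_one : (1 : CycAlg R).b0 = 0 := rfl
@[simp] theorem b0_add (x y : CycAlg R) : (x + y).b0 = x.b0 + y.b0 := rfl
@[simp] theorem b0_neg (x : CycAlg R) : (-x).b0 = -x.b0 := rfl
@[simp] theorem b0_mul (x y : CycAlg R) : (x * y).b0 =
    x.a0 * y.b0 + x.b0 * y.d0 := rfl
@[simp] theorem b1_zero : (0 : CycAlg R).b1 = 0 := rfl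
@[simp] theorem b1_one : (1 : CycAlg R).b1 = 0 := rfl
@[simp] theorem b1_add (x y : CycAlg R) : (x + y).b1 = x.b1 + y.b1 := rfl
@[simp] theorem b1_neg (x : CycAlg R) : (-x).b1 = -x.b1 := rfl
@[simp] theorem b1_mul (x y : CycAlg R) : (x * y).b1 =
    x.a0 * y.b1 + x.a1 * y.b0 + x.b0 * y.d1 + x.b1 * y.d0 := rfl
@[simp] theorem c0_zero : (0 : CycAlg R).c0 = 0 := rfl
@[simp] theorem c0_one : (1 : CycAlg R).c0 = 0 := rfl
@[simp] theorem c0_add (x y : CycAlg R) : (x + y).c0 = x.c0 + y.c0 := rfl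
@[simp] theorem c0_neg (x : CycAlg R) : (-x).c0 = -x.c0 := rfl
@[simp] theorem c0_mul (x y : CycAlg R) : (x * y).c0 =
    x.c0 * y.a0 + x.d0 * y.c0 := rfl
@[simp] theorem c1_zero : (0 : CycAlg R).c1 = 0 := rfl
@[simp] theorem c1_one : (1 : CycAlg R).c1 = 0 := rfl
@[simp] theorem c1_add (x y : CycAlg R) : (x + y).c1 = x.c1 + y.c1 := rfl
@[simp] theorem c1_neg (x : CycAlg R) : (-x).c1 = -x.c1 := rfl
@[simp] theorem c1_mul (x y : CycAlg R) : (x * y).c1 =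
    x.c0 * y.a1 + x.c1 * y.a0 + x.d0 * y.c1 + x.d1 * y.c0 := rfl
@[simp] theorem d0_zero : (0 : CycAlg R).d0 = 0 := rfl
@[simp] theorem d0_one : (1 : CycAlg R).d0 = 1 := rfl
@[simp] theorem d0_add (x y : CycAlg R) : (x + y).d0 = x.d0 + y.d0 := rfl
@[simp] theorem d0_neg (x : CycAlg R) : (-x).d0 = -x.d0 := rfl
@[simp] theorem d0_mul (x y : CycAlg R) : (x * y).d0 =
    x.d0 * y.d0 := rfl
@[simp] theorem d1_zero : (0 : CycAlg R).d1 = 0 := rfl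
@[simp] theorem d1_one : (1 : CycAlg R).d1 = 0 := rfl
@[simp] theorem d1_add (x y : CycAlg R) : (x + y).d1 = x.d1 + y.d1 := rfl
@[simp] theorem d1_neg (x : CycAlg R) : (-x).d1 = -x.d1 := rfl
@[simp] theorem d1_mul (x y : CycAlg R) : (x * y).d1 =
    x.d0 * y.d1 + x.d1 * y.d0 + x.c0 * y.b0 := rfl
@[simp] theorem d2_zero : (0 : CycAlg R).d2 = 0 := rfl
@[simp] theorem d2_one : (1 : CycAlg R).d2 = 0 := rfl
@[simp] theorem d2_add (x y : CycAlg R) : (x + y).d2 = x.d2 + y.d2 := rfl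
@[simp] theorem d2_neg (x : CycAlg R) : (-x).d2 = -x.d2 := rfl
@[simp] theorem d2_mul (x y : CycAlg R) : (x * y).d2 =
    x.d0 * y.d2 + x.d1 * y.d1 + x.d2 * y.d0 + x.c0 * y.b1 + x.c1 * y.b0 := rfl

instance : AddCommGroup (CycAlg R) where
  add_assoc x y z := by ext <;> simp [add_assoc]
  zero_add x := by ext <;> simp
  add_zero x := by ext <;> simp
  add_comm x y := by ext <;> simp [add_comm]
  neg_add_cancel x := by ext <;> simp
  nsmul := nsmulRec
  zsmul := zsmulRec

instance : Ring (CycAlg R) where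
  mul_assoc x y z := by ext <;> simp <;> ring
  one_mul x := by ext <;> simp
  mul_one x := by ext <;> simp
  left_distrib x y z := by ext <;> simp <;> ring
  right_distrib x y z := by ext <;> simp <;> ring
  zero_mul x := by ext <;> simp
  mul_zero x := by ext <;> simp
  neg_add_cancel x := by ext <;> simp
  zsmul := zsmulRec

instance : Algebra R (CycAlg R) :=
  RingHom.toAlgebra'
    { toFun := fun r => ⟨r, 0, 0, 0, 0, 0, 0, r, 0, 0⟩
      map_one' := rfl
      map_mul' := fun r s => by ext <;> simp
      map_zero' := rfl
      map_add' := fun r s => by ext <;> simp }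
    fun r x => by ext <;> simp [mul_comm]

theorem algebraMap_apply (r : R) :
    algebraMap R (CycAlg R) r = ⟨r, 0, 0, 0, 0, 0, 0, r, 0, 0⟩ := rfl

theorem smul_eq (r : R) (x : CycAlg R) : r • x = ⟨r * x.a0, r * x.a1, r * x.a2, r * x.b0, r * x.b1,
    r * x.c0, r * x.c1, r * x.d0, r * x.d1, r * x.d2⟩ := by
  rw [Algebra.smul_def, algebraMap_apply]
  ext <;> simp

theorem algebraMap_injective : Function.Injective (algebraMap R (CycAlg R)) := fun _ _ h =>
  congrArg CycAlg.a0 h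

instance (p : ℕ) [CharP R p] : CharP (CycAlg R) p :=
  charP_of_injective_algebraMap algebraMap_injective p

/-! ### The group algebra of the dihedral group of order ten in characteristic five -/

/-- The exponential of `k z`, where `z = [[0, y], [y, 0]]`, in characteristic five: the inverses of
`2`, `6` and `24` are `3`, `1` and `-1`. -/
def exp (k : R) : CycAlg R := ⟨1, 3 * k ^ 2, -k ^ 4, k, k ^ 3, k, k ^ 3, 1, 3 * k ^ 2, -k ^ 4⟩

theorem exp_add (h5 : (5 : R) = 0) (i j : R) : exp (i + j) = exp i * exp j := by
  ext <;> simp [exp]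
  · linear_combination i * j * h5
  · linear_combination (-(i ^ 3 * j) - 3 * i ^ 2 * j ^ 2 - i * j ^ 3) * h5
  · ring
  · ring
  · ring
  · linear_combination i * j * h5
  · linear_combination (-(i ^ 3 * j) - 3 * i ^ 2 * j ^ 2 - i * j ^ 3) * h5

theorem exp_zero : exp (0 : R) = 1 := by
  ext <;> simp [exp]

theorem exp_pow (h5 : (5 : R) = 0) (i : R) (n : ℕ) : exp i ^ n = exp (n * i) := by
  induction n with
  | zero => simp [exp_zero]
  | succ n ih => rw [pow_succ, ih, ← exp_add h5]; push_cast; ring_nf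

/-- The diagonal matrix with entries `1` and `-1`, the image of a reflection. -/
def sgn : CycAlg R := ⟨1, 0, 0, 0, 0, 0, 0, -1, 0, 0⟩

theorem sgn_mul_sgn : (sgn : CycAlg R) * sgn = 1 := by
  ext <;> simp [sgn]

theorem exp_mul_sgn_mul_exp (h5 : (5 : R) = 0) (k : R) : exp k * sgn * exp k = sgn := by
  have h : exp k * sgn = sgn * exp (-k) := by
    ext <;> simp [exp, sgn] <;> ring
  rw [h, mul_assoc, ← exp_add h5, neg_add_cancel, exp_zero, mul_one]

/-- The Vandermonde matrix of the five elements of the prime field is invertible: the value of `u`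
at `j` is the sum of `u i (1 - (i - j) ^ 4)`. -/
theorem eq_zero_of_moments (h5 : (5 : R) = 0) (u : Fin 5 → R)
    (m : ∀ k : Fin 5, ∑ i : Fin 5, u i * (i : ℕ) ^ (k : ℕ) = 0) (j : Fin 5) : u j = 0 := by
  have m0 := m 0
  have m1 := m 1
  have m2 := m 2
  have m3 := m 3
  have m4 := m 4
  simp [Fin.sum_univ_five] at m0 m1 m2 m3 m4
  fin_cases j
  · change u 0 = 0
    linear_combination m0 - m4 + (3 * u 2 + 16 * u 3 + 51 * u 4) * h5
  · change u 1 = 0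
    linear_combination -m4 + 4 * m3 - 6 * m2 + 4 * m1 + (3 * u 3 + 16 * u 4) * h5
  · change u 2 = 0
    linear_combination -15 * m0 - m4 + 8 * m3 - 24 * m2 + 32 * m1 + (3 * u 0 + 3 * u 4) * h5
  · change u 3 = 0
    linear_combination -80 * m0 - m4 + 12 * m3 - 54 * m2 + 108 * m1 + (16 * u 0 + 3 * u 1) * h5
  · change u 4 = 0
    linear_combination -255 * m0 - m4 + 16 * m3 - 96 * m2 + 256 * m1 + (51 * u 0 + 16 * u 1 +
      3 * u 2) * h5

end CycAlg

open CycAlg in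
/-- In characteristic five, `R[D₁₀]` is the truncated algebra of the cyclic quiver: the generating
rotation is an exponential of a generator of the radical. -/
theorem nonempty_algEquiv_cycAlg (R : Type*) [CommRing R] [Finite R] [CharP R 5] :
    Nonempty (MonoidAlgebra R (DihedralGroup 5) ≃ₐ[R] CycAlg R) := by
  have h5 : (5 : R) = 0 := by exact_mod_cast CharP.cast_eq_zero R 5
  have hg : exp (1 : R) ^ 5 = 1 := by
    rw [exp_pow h5, CharP.cast_eq_zero, zero_mul, exp_zero]
  refine nonempty_algEquiv_of_injective (MonoidAlgebra.lift R _ (DihedralGroup 5)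
    (dihedralLift (exp 1) sgn hg sgn_mul_sgn (exp_mul_sgn_mul_exp h5 1))) ?_ ?_
  · rw [injective_iff_map_eq_zero]
    intro x hx
    rw [lift_apply_dihedralGroup_five] at hx
    change ∑ i : Fin 5, x.coeff (.r i) • exp (1 : R) ^ (i : ℕ) +
      ∑ i : Fin 5, x.coeff (.sr i) • (sgn * exp (1 : R) ^ (i : ℕ)) = 0 at hx
    simp only [exp_pow h5, mul_one, smul_eq, Fin.sum_univ_five] at hx
    have hc := CycAlg.ext_iff.1 hx
    simp [exp, sgn] at hc
    obtain ⟨ha0, ha1, ha2, hb0, hb1, hc0, hc1, hd0, hd1, hd2⟩ := hc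
    -- the coordinates are multiples of the moments of `p + q` and `p - q`, where `p` and `q` are
    -- the coefficients of rotations and reflections
    have hp : ∀ i : Fin 5, x.coeff (.r i) + x.coeff (.sr i) = 0 := by
      refine eq_zero_of_moments h5 _ fun k => ?_
      fin_cases k <;> simp [Fin.sum_univ_five]
      · linear_combination ha0
      · linear_combination hb0
      · linear_combination 2 * ha1 - ((x.coeff (.r 1) + x.coeff (.sr 1)) + 4 * (x.coeff (.r 2) +
        x.coeff (.sr 2)) + 9 * (x.coeff (.r 3) + x.coeff (.sr 3)) +
        16 * (x.coeff (.r 4) + x.coeff (.sr 4))) * h5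
      · linear_combination hb1
      · linear_combination -ha2
    have hq : ∀ i : Fin 5, x.coeff (.r i) - x.coeff (.sr i) = 0 := by
      refine eq_zero_of_moments h5 _ fun k => ?_
      fin_cases k <;> simp [Fin.sum_univ_five]
      · linear_combination hd0
      · linear_combination hc0
      · linear_combination 2 * hd1 - ((x.coeff (.r 1) - x.coeff (.sr 1)) + 4 * (x.coeff (.r 2) -
        x.coeff (.sr 2)) + 9 * (x.coeff (.r 3) - x.coeff (.sr 3)) +
        16 * (x.coeff (.r 4) - x.coeff (.sr 4))) * h5
      · linear_combination hc1
      · linear_combination -hd2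
    refine monoidAlgebra_dihedralGroup_eq_zero (fun i => ?_) fun i => ?_
    · linear_combination 3 * hp i + 3 * hq i - x.coeff (.r i) * h5
    · linear_combination 3 * hp i - 3 * hq i - x.coeff (.sr i) * h5
  · rw [natCard_monoidAlgebra, CycAlg.natCard, DihedralGroup.card]

/-! ### Jacobson radicals and the group `1 + J` -/

theorem mem_oneAddJacobson {A : Type*} [Ring A] {u : Aˣ} :
    u ∈ oneAddJacobson A ↔ (u : A) - 1 ∈ Ring.jacobson A :=
  ⟨fun ⟨j, hj, h⟩ => by rwa [h, add_sub_cancel_left], fun h => ⟨_, h, by abel⟩⟩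

theorem ringEquiv_apply_mem_jacobson {A B : Type*} [Ring A] [Ring B] (e : A ≃+* B) {x : A}
    (hx : x ∈ Ring.jacobson A) : e x ∈ Ring.jacobson B :=
  have : RingHomSurjective (e : A →+* B) := ⟨e.surjective⟩
  Ring.le_comap_jacobson (e : A →+* B) hx

/-- The group `1 + J` is functorial for ring isomorphisms. -/
theorem nonempty_oneAddJacobson_mulEquiv {A B : Type*} [Ring A] [Ring B] (e : A ≃+* B) :
    Nonempty (oneAddJacobson A ≃* oneAddJacobson B) := by
  have h : (oneAddJacobson A).map (Units.mapEquiv e.toMulEquiv).toMonoidHom = oneAddJacobson B := by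
    ext u
    rw [Subgroup.mem_map_equiv, mem_oneAddJacobson, mem_oneAddJacobson]
    have h1 : (((Units.mapEquiv e.toMulEquiv).symm u : Aˣ) : A) - 1 = e.symm (u - 1) := by
      simp
    rw [h1]
    exact ⟨fun h => by simpa using ringEquiv_apply_mem_jacobson e h,
      ringEquiv_apply_mem_jacobson e.symm⟩
  exact ⟨((Units.mapEquiv e.toMulEquiv).subgroupMap _).trans (MulEquiv.subgroupCongr h)⟩

/-- A nil kernel of a homomorphism onto a ring without Jacobson radical is the Jacobson radical. -/
theorem mem_jacobson_iff_of_nil_ker {A B : Type*} [Ring A] [Ring B] (f : A →+* B)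
    (hf : Function.Surjective f) (hB : Ring.jacobson B = ⊥)
    (hn : ∀ x, f x = 0 → IsNilpotent x) {x : A} : x ∈ Ring.jacobson A ↔ f x = 0 := by
  constructor
  · intro hx
    have : RingHomSurjective f := ⟨hf⟩
    have h := Ring.le_comap_jacobson f hx
    rwa [Ideal.mem_comap, hB, Ideal.mem_bot] at h
  · intro hx
    rw [← Ideal.jacobson_bot, Ideal.mem_jacobson_iff]
    intro y
    obtain ⟨u, hu⟩ := (hn (y * x) (by rw [map_mul, hx, mul_zero])).isUnit_one_add
    refine ⟨((u⁻¹ : Aˣ) : A), ?_⟩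
    have h : ((u⁻¹ : Aˣ) : A) * (1 + y * x) = 1 := by rw [← hu, Units.inv_mul]
    rw [Ideal.mem_bot, mul_assoc, ← sub_eq_zero.2 h]
    noncomm_ring

theorem jacobson_eq_bot_of_isReduced (R : Type*) [CommRing R] [Finite R] [IsReduced R] :
    Ring.jacobson R = ⊥ :=
  IsArtinianRing.isSemisimpleRing_iff_jacobson.1 (IsArtinianRing.isSemisimpleRing_of_isReduced R)

theorem IsoSemidirect.natCard_eq {X N H : Type*} [Group X] [Group N] [Group H]
    (h : IsoSemidirect X N H) : Nat.card X = Nat.card N * Nat.card H := by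
  obtain ⟨φ, ⟨e⟩⟩ := h
  rw [Nat.card_congr e.toEquiv, SemidirectProduct.card]

/-! ### The unit group of the truncated quiver algebra -/

namespace CycAlg

variable {R : Type*} [CommRing R]

/-- The constant terms of the diagonal entries; this is reduction modulo the radical. -/
def diag (R : Type*) [CommRing R] : CycAlg R →+* R × R where
  toFun x := (x.a0, x.d0)
  map_one' := rfl
  map_mul' _ _ := rfl
  map_zero' := rfl
  map_add' _ _ := rfl

/-- Constant diagonal matrices, a section of `diag`. -/
def ofDiag (R : Type*) [CommRing R] : R × R →+* CycAlg R where
  toFun r := ⟨r.1, 0, 0, 0, 0, 0, 0, r.2, 0, 0⟩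
  map_one' := rfl
  map_mul' r s := by ext <;> simp
  map_zero' := rfl
  map_add' r s := by ext <;> simp

theorem pow_five_eq_zero {x : CycAlg R} (ha : x.a0 = 0) (hd : x.d0 = 0) : x ^ 5 = 0 := by
  have h2 : x * x = ⟨0, x.b0 * x.c0, x.a1 * x.a1 + x.b0 * x.c1 + x.b1 * x.c0, 0,
      x.a1 * x.b0 + x.b0 * x.d1, 0, x.c0 * x.a1 + x.d1 * x.c0, 0, x.c0 * x.b0,
      x.d1 * x.d1 + x.c0 * x.b1 + x.c1 * x.b0⟩ := by
    ext <;> simp [ha, hd]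
  have h4 : x * x * (x * x) = ⟨0, 0, x.b0 * x.c0 * (x.b0 * x.c0), 0, 0, 0, 0, 0, 0,
      x.c0 * x.b0 * (x.c0 * x.b0)⟩ := by
    rw [h2]
    ext <;> simp
  have h5 : x ^ 5 = x * x * (x * x) * x := by noncomm_ring
  rw [h5, h4]
  ext <;> simp [ha, hd]

theorem mem_jacobson_iff [Finite R] [IsReduced R] {x : CycAlg R} :
    x ∈ Ring.jacobson (CycAlg R) ↔ x.a0 = 0 ∧ x.d0 = 0 := by
  rw [mem_jacobson_iff_of_nil_ker (diag R) (fun r => ⟨ofDiag R r, rfl⟩)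
    (jacobson_eq_bot_of_isReduced _) fun x hx => ⟨5, ?_⟩]
  · exact Prod.mk_eq_zero
  · exact pow_five_eq_zero (congrArg Prod.fst hx) (congrArg Prod.snd hx)

/-- The group of matrices with diagonal constant terms one. -/
def V (R : Type*) [CommRing R] : Subgroup (CycAlg R)ˣ := (Units.map (diag R).toMonoidHom).ker

theorem mem_V {u : (CycAlg R)ˣ} : u ∈ V R ↔ u.val.a0 = 1 ∧ u.val.d0 = 1 := by
  rw [V, MonoidHom.mem_ker, Units.ext_iff]
  exact Prod.mk_inj

theorem oneAddJacobson_eq [Finite R] [IsReduced R] : oneAddJacobson (CycAlg R) = V R := by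
  ext u
  rw [mem_oneAddJacobson, mem_jacobson_iff, mem_V]
  simp [sub_eq_add_neg, add_neg_eq_zero]

theorem isoSemidirect_units (R : Type*) [CommRing R] :
    IsoSemidirect (CycAlg R)ˣ (V R) (R × R)ˣ :=
  isoSemidirect_ker _ (Units.map (ofDiag R).toMonoidHom) fun _ => Units.ext rfl

theorem V_a0 (u : V R) : u.val.val.a0 = 1 := (mem_V.1 u.2).1

theorem V_d0 (u : V R) : u.val.val.d0 = 1 := (mem_V.1 u.2).2

theorem V_ext {u v : V R} (h : u.val.val = v.val.val) : u = v := Subtype.ext (Units.ext h)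

/-- An element with diagonal constant terms one is invertible. -/
noncomputable def toV (x : CycAlg R) (ha : x.a0 = 1) (hd : x.d0 = 1) : V R :=
  have h : IsUnit x := by
    have := IsNilpotent.isUnit_one_add (r := x - 1) ⟨5, pow_five_eq_zero
      (by simp [sub_eq_add_neg, ha]) (by simp [sub_eq_add_neg, hd])⟩
    rwa [add_sub_cancel] at this
  ⟨h.unit, mem_V.2 ⟨ha, hd⟩⟩

@[simp]
theorem val_toV (x : CycAlg R) (ha : x.a0 = 1) (hd : x.d0 = 1) : (toV x ha hd).val.val = x := rfl

theorem V_pow_five [CharP R 5] (u : V R) : u ^ 5 = 1 := by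
  have : Fact (Nat.Prime 5) := ⟨Nat.prime_five⟩
  have h : (u.val.val - 1) ^ 5 = 0 :=
    pow_five_eq_zero (by simp [sub_eq_add_neg, V_a0]) (by simp [sub_eq_add_neg, V_d0])
  rw [sub_pow_char_of_commute 5 (Commute.one_right _), one_pow, sub_eq_zero] at h
  exact V_ext h

/-- The coordinates of an element of `V`. -/
noncomputable def equivV (R : Type*) [CommRing R] : V R ≃ (R × R × R × R) × (R × R × R × R) where
  toFun u := ((u.val.val.a1, u.val.val.a2, u.val.val.b0, u.val.val.b1),
    (u.val.val.c0, u.val.val.c1, u.val.val.d1, u.val.val.d2))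
  invFun w := toV ⟨1, w.1.1, w.1.2.1, w.1.2.2.1, w.1.2.2.2, w.2.1, w.2.2.1, 1, w.2.2.2.1,
    w.2.2.2.2⟩ rfl rfl
  left_inv u := V_ext (by ext <;> simp [V_a0, V_d0])
  right_inv w := rfl

theorem natCard_V (R : Type*) [CommRing R] : Nat.card (V R) = Nat.card R ^ 8 := by
  rw [Nat.card_congr (equivV R)]
  simp only [Nat.card_prod]
  ring

/-- The coefficient of `y` in the upper right entry, a homomorphism. -/
def upper (R : Type*) [CommRing R] : V R →* Multiplicative R where
  toFun u := .ofAdd u.val.val.b0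
  map_one' := rfl
  map_mul' u v := by simp [V_a0, V_d0, add_comm, ← ofAdd_add]

/-- The elementary matrices `1 + x y E₁₂`, a section of `upper`. -/
noncomputable def upperSection (R : Type*) [CommRing R] : Multiplicative R →* V R where
  toFun x := toV ⟨1, 0, 0, x.toAdd, 0, 0, 0, 1, 0, 0⟩ rfl rfl
  map_one' := V_ext rfl
  map_mul' x y := V_ext (by ext <;> simp [add_comm])

theorem b0_ker_upper (u : (upper R).ker) : u.val.val.val.b0 = 0 := u.2

/-- On the kernel of `upper`, the coefficient of `y` in the lower left entry and the coefficient of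
`y²` in the lower right entry are homomorphisms. -/
def lower (R : Type*) [CommRing R] : (upper R).ker →* Multiplicative (R × R) where
  toFun u := .ofAdd (u.val.val.val.c0, u.val.val.val.d1)
  map_one' := rfl
  map_mul' u v := by simp [V_a0, V_d0, b0_ker_upper, add_comm, ← ofAdd_add]

/-- A section of `lower`: the commuting products of the scalars `exp (s y²)` with the elementary
matrices `1 + c y E₂₁`. In characteristic five, the inverse of `2` is `3`. -/
noncomputable def lowerSection (R : Type*) [CommRing R] [CharP R 5] :
    Multiplicative (R × R) →* (upper R).ker where
  toFun x := ⟨toV ⟨1, x.toAdd.2, 3 * x.toAdd.2 ^ 2, 0, 0, x.toAdd.1, x.toAdd.2 * x.toAdd.1,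
    1, x.toAdd.2, 3 * x.toAdd.2 ^ 2⟩ rfl rfl, rfl⟩
  map_one' := Subtype.ext (V_ext (by ext <;> simp))
  map_mul' x y := by
    have h5 : (5 : R) = 0 := by exact_mod_cast CharP.cast_eq_zero R 5
    refine Subtype.ext (V_ext ?_)
    ext <;> simp
    · ring
    · linear_combination x.toAdd.2 * y.toAdd.2 * h5
    · ring
    · ring
    · linear_combination x.toAdd.2 * y.toAdd.2 * h5

theorem isoSemidirect_V (R : Type*) [CommRing R] :
    IsoSemidirect (V R) (upper R).ker (Multiplicative R) :=
  isoSemidirect_ker _ (upperSection R) fun _ => rfl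

theorem isoSemidirect_ker_upper (R : Type*) [CommRing R] [CharP R 5] :
    IsoSemidirect (upper R).ker (lower R).ker (Multiplicative (R × R)) :=
  isoSemidirect_ker _ (lowerSection R) fun _ => rfl

theorem natCard_ker_lower (R : Type*) [CommRing R] [CharP R 5] [Finite R] :
    Nat.card (lower R).ker = Nat.card R ^ 5 := by
  have h1 := (isoSemidirect_V R).natCard_eq
  rw [(isoSemidirect_ker_upper R).natCard_eq, natCard_V] at h1
  have h2 : Nat.card (Multiplicative (R × R)) = Nat.card R ^ 2 := by
    rw [Nat.card_congr Multiplicative.toAdd, Nat.card_prod, pow_two]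
  have h3 : Nat.card (Multiplicative R) = Nat.card R := Nat.card_congr Multiplicative.toAdd
  rw [h2, h3] at h1
  have hR : 0 < Nat.card R := Nat.card_pos
  exact Nat.eq_of_mul_eq_mul_right (pow_pos hR 3) (by linarith)

theorem ker_lower_mul_comm (u v : (lower R).ker) : u * v = v * u := by
  have h (w : (lower R).ker) : w.val.val.val.val.b0 = 0 ∧ w.val.val.val.val.c0 = 0 ∧
      w.val.val.val.val.d1 = 0 := ⟨w.1.2, congrArg Prod.fst w.2, congrArg Prod.snd w.2⟩
  obtain ⟨hu1, hu2, hu3⟩ := h u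
  obtain ⟨hv1, hv2, hv3⟩ := h v
  refine Subtype.ext (Subtype.ext (V_ext ?_))
  ext <;> simp [V_a0, V_d0, hu1, hu2, hu3, hv1, hv2, hv3] <;> ring

end CycAlg

open CycAlg in
theorem isoSemidirect₂_V {R : Type*} [CommRing R] [CharP R 5] {m : ℕ} (hR : Nat.card R = 5 ^ m) :
    IsoSemidirect₂ (V R) (DirPow (C 5) (5 * m)) (DirPow (C 5) (2 * m)) (DirPow (C 5) m) := by
  have : Fact (Nat.Prime 5) := ⟨Nat.prime_five⟩
  have : Finite R := Nat.finite_of_card_ne_zero (by rw [hR]; positivity)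
  obtain ⟨eA⟩ := nonempty_mulEquiv_of_mul_comm (A := (lower R).ker) (p := 5) (n := 5 * m)
    ker_lower_mul_comm (fun u => Subtype.ext (Subtype.ext (V_pow_five _)))
    (by rw [natCard_ker_lower, hR, ← pow_mul, mul_comm])
  obtain ⟨eB⟩ := nonempty_multiplicative_mulEquiv (R := R × R) (p := 5) (n := 2 * m)
    (by rw [Nat.card_prod, hR, ← pow_add, two_mul])
  obtain ⟨eH⟩ := nonempty_multiplicative_mulEquiv (R := R) (p := 5) hR
  obtain ⟨φ, ⟨e⟩⟩ := isoSemidirect_ker_upper R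
  exact IsoSemidirect₂.congr ⟨φ, (isoSemidirect_V R).congr (.refl _) e (.refl _)⟩ (.refl _) eA eB eH

namespace CycAlg

variable {R : Type*} [CommRing R]

/-- An element of `V` that commutes with the elementary matrices `1 + y E₁₂` and `1 + y E₂₁` is
diagonal with entries that agree modulo `y⁴`. -/
theorem mem_center_V {u : V R} : u ∈ Subgroup.center (V R) ↔
    u.val.val.b0 = 0 ∧ u.val.val.b1 = 0 ∧ u.val.val.c0 = 0 ∧ u.val.val.c1 = 0 ∧
      u.val.val.d1 = u.val.val.a1 := by
  rw [Subgroup.mem_center_iff]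
  constructor
  · intro h
    have h1 := congrArg (fun v : V R => v.val.val) (h (toV ⟨1, 0, 0, 1, 0, 0, 0, 1, 0, 0⟩ rfl rfl))
    have h2 := congrArg (fun v : V R => v.val.val) (h (toV ⟨1, 0, 0, 0, 0, 1, 0, 1, 0, 0⟩ rfl rfl))
    have h1' := CycAlg.ext_iff.1 h1
    have h2' := CycAlg.ext_iff.1 h2
    simp [V_a0, V_d0] at h1' h2'
    exact ⟨h2'.1, h2'.2.1, h1'.1, h1'.2.1, by linear_combination h1'.2.2.2.1⟩
  · rintro ⟨hb0, hb1, hc0, hc1, hd⟩ v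
    refine V_ext ?_
    ext <;> simp [V_a0, V_d0, hb0, hb1, hc0, hc1, hd] <;> ring

/-- The coordinates of a central element of `V`. -/
noncomputable def equivCenter (R : Type*) [CommRing R] : Subgroup.center (V R) ≃ R × R × R where
  toFun u := (u.val.val.val.a1, u.val.val.val.a2, u.val.val.val.d2)
  invFun w := ⟨toV ⟨1, w.1, w.2.1, 0, 0, 0, 0, 1, w.1, w.2.2⟩ rfl rfl,
    mem_center_V.2 ⟨rfl, rfl, rfl, rfl, rfl⟩⟩
  left_inv u := by
    obtain ⟨hb0, hb1, hc0, hc1, hd⟩ := mem_center_V.1 u.2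
    refine Subtype.ext (V_ext ?_)
    ext <;> simp [V_a0, V_d0, hb0, hb1, hc0, hc1, hd]
  right_inv w := rfl

end CycAlg

open CycAlg in
theorem nonempty_center_V_mulEquiv {R : Type*} [CommRing R] [CharP R 5] {m : ℕ}
    (hR : Nat.card R = 5 ^ m) :
    Nonempty (Subgroup.center (V R) ≃* DirPow (C 5) (3 * m)) := by
  have : Fact (Nat.Prime 5) := ⟨Nat.prime_five⟩
  refine nonempty_mulEquiv_of_mul_comm (A := Subgroup.center (V R)) (p := 5)
    (fun u v => Subtype.ext ((Subgroup.mem_center_iff.1 v.2 u.1)))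
    (fun u => Subtype.ext (V_pow_five u.1)) ?_
  rw [Nat.card_congr (equivCenter R), Nat.card_prod, Nat.card_prod, hR]
  ring

/-! ### Unit groups of products -/

/-- The units of a direct power of matrix algebras. -/
def unitsMatrixDirPow (K : Type*) [CommRing K] (n : ℕ) : (DirPow (M2 K) n)ˣ ≃* DirPow (GL2 K) n :=
  unitsDirPow (M2 K) n

theorem nonempty_units_dirPow {K : Type*} [Field K] [Finite K] {m : ℕ} (h : Nat.card K = m)
    (n : ℕ) : Nonempty ((DirPow K n)ˣ ≃* DirPow (C (m - 1)) n) := by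
  obtain ⟨e⟩ := nonempty_units_mulEquiv_C h
  exact ⟨(unitsDirPow K n).trans (dirPowCongr e n)⟩

theorem nonempty_units_prod_dirPow {K L : Type*} [Field K] [Finite K] [Field L] [Finite L]
    {m m' : ℕ} (h : Nat.card K = m) (h' : Nat.card L = m') (n n' : ℕ) :
    Nonempty ((DirPow K n × DirPow L n')ˣ ≃* DirPow (C (m - 1)) n × DirPow (C (m' - 1)) n') := by
  obtain ⟨e⟩ := nonempty_units_dirPow h n
  obtain ⟨e'⟩ := nonempty_units_dirPow h' n'
  exact ⟨MulEquiv.prodUnits.trans (e.prodCongr e')⟩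

/-! ### Characteristic two -/

theorem isoSemidirect_units_of_char_two {F : Type*} [Field F] [CharP F 2] {R : Type*} [CommRing R]
    [Finite R] [Algebra F R] [Nontrivial R] (e : MonoidAlgebra F (C 3) ≃ₐ[F] R)
    {B : Type*} [CommRing B] [Algebra F B]
    (e' : QuadraticAlgebra R 1 (-1) ≃ₐ[F] B) {m : ℕ} (hm : Nat.card R = 2 ^ m) :
    IsoSemidirect (MonoidAlgebra F G)ˣ (DirPow (C 2) m) (Rˣ × (M2 B)ˣ) := by
  have : CharP R 2 := charP_of_injective_algebraMap (algebraMap F R).injective 2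
  obtain ⟨e₁⟩ := nonempty_algEquiv_matrix (p := 2) (by norm_num) e e'
  obtain ⟨e₂⟩ := nonempty_units_quadraticAlgebra_one_zero R
  obtain ⟨e₃⟩ := nonempty_multiplicative_mulEquiv (R := R) (p := 2) hm
  exact isoSemidirect_of_mulEquiv_prod ((Units.mapEquiv e₁.toMulEquiv).trans
    (MulEquiv.prodUnits.trans (((e₂.trans (e₃.prodCongr (.refl _))).prodCongr (.refl _)).trans
      MulEquiv.prodAssoc)))

/-! ### Semisimplicity -/

theorem isSemisimpleRing_monoidAlgebra_G (F : Type*) [Field F] (p : ℕ) [Fact p.Prime] [CharP F p]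
    (hp : 5 < p) : IsSemisimpleRing (MonoidAlgebra F G) := by
  have h : IsUnit ((30 : ℕ) : F) := by
    have h2 := isUnit_natCast_of_ne (F := F) (p := p) Nat.prime_two (by omega) F
    have h3 := isUnit_natCast_of_ne (F := F) (p := p) Nat.prime_three (by omega) F
    have h5 := isUnit_natCast_of_ne (F := F) (p := p) Nat.prime_five (by omega) F
    exact_mod_cast (h2.mul h3).mul h5
  have hG : Nat.card G = 30 := by
    rw [Nat.card_prod, DihedralGroup.nat_card, Nat.card_congr Multiplicative.toAdd, Nat.card_zmod]
  have : NeZero (Nat.card G : F) := ⟨by rw [hG]; exact h.ne_zero⟩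
  infer_instance

section Assembly

variable (F : Type*) [Field F] (p : ℕ) [Fact p.Prime] [CharP F p]

/-! ### The group algebra of the cyclic group of order six -/

theorem nonempty_monoidAlgebra_C_six (hp2 : p ≠ 2) {R : Type*} [CommRing R] [Finite R] [Algebra F R]
    (e : MonoidAlgebra F (C 3) ≃ₐ[F] R) : Nonempty (MonoidAlgebra F (C 6) ≃ₐ[F] R × R) := by
  let g : C 6 ≃* C 2 × C 3 :=
    (AddEquiv.toMultiplicative
      (ZMod.chineseRemainder (m := 2) (n := 3) (by norm_num)).toAddEquiv).trans
        (MulEquiv.prodMultiplicative _ _)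
  obtain ⟨e₁⟩ := nonempty_monoidAlgebra_C_two (R := R)
  obtain ⟨e₂⟩ := nonempty_quadraticAlgebra_one_zero (F := F) hp2 R
  exact ⟨(MonoidAlgebra.domCongr F F g).trans ((MonoidAlgebra.curryAlgEquiv F).trans
    ((MonoidAlgebra.mapAlgEquiv F _ e).trans ((e₁.restrictScalars F).trans e₂)))⟩

variable [Finite F]

theorem nonempty_C_six_of_mod_eq_one (hp2 : p ≠ 2) (hp3 : p ≠ 3) (h : Nat.card F % 3 = 1) :
    Nonempty (MonoidAlgebra F (C 6) ≃ₐ[F] DirPow F 6) := by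
  obtain ⟨e⟩ := nonempty_algEquiv_C_three_of_mod_eq_one F p hp3 h
  obtain ⟨e'⟩ := nonempty_monoidAlgebra_C_six F p hp2 e
  exact ⟨e'.trans (dirPowAdd F F 3 3)⟩

theorem nonempty_C_six_of_mod_eq_two (hp2 : p ≠ 2) (hp3 : p ≠ 3) (h : Nat.card F % 3 = 2) :
    Nonempty (MonoidAlgebra F (C 6) ≃ₐ[F] DirPow F 2 × DirPow (QuadExt F p) 2) := by
  obtain ⟨e⟩ := nonempty_algEquiv_C_three_of_mod_eq_two F p hp3 h
  obtain ⟨e'⟩ := nonempty_monoidAlgebra_C_six F p hp2 e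
  obtain ⟨e''⟩ := nonempty_prod_prod_quadExt F p
  exact ⟨e'.trans e''⟩

/-! ### Semisimple decompositions -/

theorem nonempty_algEquiv_one_split (hp2 : p ≠ 2) (hp3 : p ≠ 3) (hp5 : p ≠ 5)
    (h3 : Nat.card F % 3 = 1) (h5 : Nat.card F % 5 = 1 ∨ Nat.card F % 5 = 4) :
    Nonempty (MonoidAlgebra F G ≃ₐ[F] DirPow F 6 × DirPow (M2 F) 6) := by
  obtain ⟨e⟩ := nonempty_algEquiv_C_three_of_mod_eq_one F p hp3 h3
  obtain ⟨e₁⟩ := nonempty_golden_one_split F p hp5 h5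
  obtain ⟨e₂⟩ := nonempty_algEquiv_matrix hp5 e e₁
  obtain ⟨e₃⟩ := nonempty_quadraticAlgebra_one_zero (F := F) hp2 (DirPow F 3)
  exact ⟨e₂.trans (AlgEquiv.prodCongr (e₃.trans (dirPowAdd F F 3 3)) (matrixDirPow F F 6))⟩

theorem nonempty_algEquiv_two_split (hp2 : p ≠ 2) (hp3 : p ≠ 3) (hp5 : p ≠ 5)
    (h3 : Nat.card F % 3 = 2) (h5 : Nat.card F % 5 = 1 ∨ Nat.card F % 5 = 4) :
    Nonempty (MonoidAlgebra F G ≃ₐ[F] DirPow F 2 × DirPow (QuadExt F p) 2 ×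
      DirPow (M2 F) 2 × DirPow (M2 (QuadExt F p)) 2) := by
  obtain ⟨e⟩ := nonempty_algEquiv_C_three_of_mod_eq_two F p hp3 h3
  obtain ⟨e₁⟩ := nonempty_golden_two_split F p hp5 h5
  obtain ⟨e₂⟩ := nonempty_algEquiv_matrix hp5 e e₁
  obtain ⟨e₃⟩ := nonempty_quadraticAlgebra_one_zero (F := F) hp2 (F × QuadExt F p)
  obtain ⟨e₄⟩ := nonempty_prod_prod_quadExt F p
  exact ⟨e₂.trans ((AlgEquiv.prodCongr (e₃.trans e₄) ((matrixProd F _ _).trans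
    (AlgEquiv.prodCongr (matrixDirPow F F 2) (matrixDirPow F (QuadExt F p) 2)))).trans
      (algProdAssoc F _ _ _))⟩

theorem nonempty_algEquiv_one_inert (hp2 : p ≠ 2) (hp3 : p ≠ 3) (hp5 : p ≠ 5)
    (h3 : Nat.card F % 3 = 1) (h5 : Nat.card F % 5 = 2 ∨ Nat.card F % 5 = 3) :
    Nonempty (MonoidAlgebra F G ≃ₐ[F] DirPow F 6 × DirPow (M2 (QuadExt F p)) 3) := by
  obtain ⟨e⟩ := nonempty_algEquiv_C_three_of_mod_eq_one F p hp3 h3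
  obtain ⟨e₁⟩ := nonempty_golden_one_inert F p h5
  obtain ⟨e₂⟩ := nonempty_algEquiv_matrix hp5 e e₁
  obtain ⟨e₃⟩ := nonempty_quadraticAlgebra_one_zero (F := F) hp2 (DirPow F 3)
  exact ⟨e₂.trans (AlgEquiv.prodCongr (e₃.trans (dirPowAdd F F 3 3)) (matrixDirPow F _ 3))⟩

theorem nonempty_algEquiv_two_inert (hp2 : p ≠ 2) (hp3 : p ≠ 3) (hp5 : p ≠ 5)
    (h3 : Nat.card F % 3 = 2) (h5 : Nat.card F % 5 = 2 ∨ Nat.card F % 5 = 3) :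
    Nonempty (MonoidAlgebra F G ≃ₐ[F] DirPow F 2 × DirPow (QuadExt F p) 2 ×
      DirPow (M2 (QuadExt F p)) 3) := by
  obtain ⟨e⟩ := nonempty_algEquiv_C_three_of_mod_eq_two F p hp3 h3
  obtain ⟨e₁⟩ := nonempty_golden_two_inert F p hp5 h5
  obtain ⟨e₂⟩ := nonempty_algEquiv_matrix hp5 e e₁
  obtain ⟨e₃⟩ := nonempty_quadraticAlgebra_one_zero (F := F) hp2 (F × QuadExt F p)
  obtain ⟨e₄⟩ := nonempty_prod_prod_quadExt F p
  exact ⟨e₂.trans ((AlgEquiv.prodCongr (e₃.trans e₄) (matrixDirPow F (QuadExt F p) 3)).trans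
    (algProdAssoc F _ _ _))⟩

end Assembly

/-! ### Characteristic five -/

/-- The unit group of the group algebra, and the group `1 + J`, in characteristic five, in terms of
the ring `R = F[C₃]`. -/
theorem structure_of_char_five {F : Type*} [Field F] [CharP F 5] {R : Type*} [CommRing R] [Finite R]
    [Algebra F R] [Nontrivial R] [IsReduced R] (e : MonoidAlgebra F (C 3) ≃ₐ[F] R) {m : ℕ}
    (hm : Nat.card R = 5 ^ m) :
    IsoSemidirect (MonoidAlgebra F G)ˣ
      (oneAddJacobson (MonoidAlgebra F G)) (MonoidAlgebra F (C 6))ˣ ∧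
    IsoSemidirect₂ (oneAddJacobson (MonoidAlgebra F G))
      (DirPow (C 5) (5 * m)) (DirPow (C 5) (2 * m)) (DirPow (C 5) m) ∧
    Nonempty (Subgroup.center (oneAddJacobson (MonoidAlgebra F G)) ≃* DirPow (C 5) (3 * m)) := by
  have : CharP R 5 := charP_of_injective_algebraMap (algebraMap F R).injective 5
  have : Fact (Nat.Prime 5) := ⟨Nat.prime_five⟩
  obtain ⟨e₁⟩ := nonempty_algEquiv_dihedral e
  obtain ⟨e₂⟩ := nonempty_algEquiv_cycAlg R
  let E : MonoidAlgebra F G ≃+* CycAlg R := e₁.toRingEquiv.trans e₂.toRingEquiv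
  obtain ⟨eV⟩ := nonempty_oneAddJacobson_mulEquiv E
  rw [CycAlg.oneAddJacobson_eq] at eV
  obtain ⟨e₃⟩ := nonempty_monoidAlgebra_C_six F 5 (by norm_num) e
  obtain ⟨eZ⟩ := nonempty_center_V_mulEquiv hm
  exact ⟨(CycAlg.isoSemidirect_units R).congr (Units.mapEquiv E.toMulEquiv).symm eV.symm
      (Units.mapEquiv e₃.toMulEquiv).symm,
    (isoSemidirect₂_V hm).congr eV.symm (.refl _) (.refl _) (.refl _),
    ⟨(Subgroup.centerCongr eV).trans eZ⟩⟩

end GroupAlgebraC3D10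

open GroupAlgebraC3D10 in
theorem mainTheorem1 (F : Type*) [Field F] [Fintype F] (p k q : ℕ) [Fact p.Prime] [CharP F p]
    (hp3 : p ≠ 3) (hqk : q = p ^ k) (hq : Fintype.card F = q) :
    -- characteristic 2
    (p = 2 →
      (q ≡ 1 [ZMOD 15] ∨ q ≡ 4 [ZMOD 15] ∨ q ≡ 2 [ZMOD 15] ∨ q ≡ -7 [ZMOD 15]) ∧
      ((q ≡ 1 [ZMOD 15] ∨ q ≡ 4 [ZMOD 15]) →
        IsoSemidirect (MonoidAlgebra F G)ˣ
          (DirPow (C 2) (3 * k))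
          (DirPow (C (2 ^ k - 1)) 3 × DirPow (GL2 F) 6)) ∧
      ((q ≡ 2 [ZMOD 15] ∨ q ≡ -7 [ZMOD 15]) →
        IsoSemidirect (MonoidAlgebra F G)ˣ
          (DirPow (C 2) (3 * k))
          (C (2 ^ k - 1) × C (2 ^ (2 * k) - 1) × DirPow (GL2 (QuadExt F p)) 3))) ∧
    -- characteristic 5
    (p = 5 →
      (q ≡ 1 [ZMOD 6] ∨ q ≡ -1 [ZMOD 6]) ∧
      IsoSemidirect (MonoidAlgebra F G)ˣ
        (oneAddJacobson (MonoidAlgebra F G)) (MonoidAlgebra F (C 6))ˣ ∧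
      (q ≡ 1 [ZMOD 6] →
        Nonempty ((MonoidAlgebra F (C 6))ˣ ≃* DirPow (C (5 ^ k - 1)) 6) ∧
        IsoSemidirect (MonoidAlgebra F G)ˣ
          (oneAddJacobson (MonoidAlgebra F G)) (DirPow (C (5 ^ k - 1)) 6)) ∧
      (q ≡ -1 [ZMOD 6] →
        Nonempty ((MonoidAlgebra F (C 6))ˣ ≃*
          DirPow (C (5 ^ k - 1)) 2 × DirPow (C (5 ^ (2 * k) - 1)) 2) ∧
        IsoSemidirect (MonoidAlgebra F G)ˣ
          (oneAddJacobson (MonoidAlgebra F G))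
          (DirPow (C (5 ^ k - 1)) 2 × DirPow (C (5 ^ (2 * k) - 1)) 2)) ∧
      IsoSemidirect₂ (oneAddJacobson (MonoidAlgebra F G))
        (DirPow (C 5) (15 * k)) (DirPow (C 5) (6 * k)) (DirPow (C 5) (3 * k)) ∧
      Nonempty (Subgroup.center (oneAddJacobson (MonoidAlgebra F G)) ≃* DirPow (C 5) (9 * k))) ∧
    -- characteristic greater than 5
    (5 < p →
      IsSemisimpleRing (MonoidAlgebra F G) ∧
      (q ≡ 1 [ZMOD 30] ∨ q ≡ -11 [ZMOD 30] ∨ q ≡ -1 [ZMOD 30] ∨ q ≡ 11 [ZMOD 30] ∨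
        q ≡ 7 [ZMOD 30] ∨ q ≡ 13 [ZMOD 30] ∨ q ≡ -7 [ZMOD 30] ∨ q ≡ -13 [ZMOD 30]) ∧
      ((q ≡ 1 [ZMOD 30] ∨ q ≡ -11 [ZMOD 30]) →
        Nonempty (MonoidAlgebra F G ≃ₐ[F] DirPow F 6 × DirPow (M2 F) 6) ∧
        Nonempty ((MonoidAlgebra F G)ˣ ≃* DirPow (C (p ^ k - 1)) 6 × DirPow (GL2 F) 6)) ∧
      ((q ≡ -1 [ZMOD 30] ∨ q ≡ 11 [ZMOD 30]) →
        Nonempty (MonoidAlgebra F G ≃ₐ[F]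
          DirPow F 2 × DirPow (QuadExt F p) 2 × DirPow (M2 F) 2 × DirPow (M2 (QuadExt F p)) 2) ∧
        Nonempty ((MonoidAlgebra F G)ˣ ≃*
          DirPow (C (p ^ k - 1)) 2 × DirPow (C (p ^ (2 * k) - 1)) 2 ×
            DirPow (GL2 F) 2 × DirPow (GL2 (QuadExt F p)) 2)) ∧
      ((q ≡ 7 [ZMOD 30] ∨ q ≡ 13 [ZMOD 30]) →
        Nonempty (MonoidAlgebra F G ≃ₐ[F] DirPow F 6 × DirPow (M2 (QuadExt F p)) 3) ∧
        Nonempty ((MonoidAlgebra F G)ˣ ≃*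
          DirPow (C (p ^ k - 1)) 6 × DirPow (GL2 (QuadExt F p)) 3)) ∧
      ((q ≡ -7 [ZMOD 30] ∨ q ≡ -13 [ZMOD 30]) →
        Nonempty (MonoidAlgebra F G ≃ₐ[F]
          DirPow F 2 × DirPow (QuadExt F p) 2 × DirPow (M2 (QuadExt F p)) 3) ∧
        Nonempty ((MonoidAlgebra F G)ˣ ≃*
          DirPow (C (p ^ k - 1)) 2 × DirPow (C (p ^ (2 * k) - 1)) 2 ×
            DirPow (GL2 (QuadExt F p)) 3))) := by
  have hcard : Nat.card F = p ^ k := by rw [Nat.card_eq_fintype_card, hq, hqk]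
  have hcardE : Nat.card (QuadExt F p) = p ^ (2 * k) := by
    rw [FiniteField.natCard_extension, hcard, ← pow_mul, mul_comm]
  have hp : p.Prime := Fact.out
  have hcardD : Nat.card (DirPow F 3) = p ^ (3 * k) := by
    rw [Nat.card_fun, hcard, Nat.card_fin, ← pow_mul, mul_comm]
  have hcardP : Nat.card (F × QuadExt F p) = p ^ (3 * k) := by
    rw [Nat.card_prod, hcard, hcardE, ← pow_add]
    congr 1
    ring
  have hmod3 : p ^ k % 3 ≠ 0 := fun h => hp3 ((Nat.prime_dvd_prime_iff_eq Nat.prime_three hp).1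
    (Nat.prime_three.dvd_of_dvd_pow (Nat.dvd_of_mod_eq_zero h))).symm
  subst hqk
  refine ⟨?_, ?_, ?_⟩
  · rintro rfl
    have hmod : 2 ^ k % 15 = 1 ∨ 2 ^ k % 15 = 2 ∨ 2 ^ k % 15 = 4 ∨ 2 ^ k % 15 = 8 := by
      clear * -
      induction k with
      | zero => simp
      | succ n ih => rw [pow_succ]; omega
    simp only [Int.ModEq]
    refine ⟨by omega, fun h => ?_, fun h => ?_⟩
    · obtain ⟨e⟩ := nonempty_algEquiv_C_three_of_mod_eq_one F 2 hp3 (by rw [hcard]; omega)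
      obtain ⟨e₁⟩ := nonempty_golden_one_split F 2 (by norm_num) (by rw [hcard]; omega)
      obtain ⟨e₂⟩ := nonempty_units_dirPow hcard 3
      exact (isoSemidirect_units_of_char_two e e₁ hcardD).congr (.refl _) (.refl _)
        (e₂.prodCongr ((Units.mapEquiv (matrixDirPow F F 6).toMulEquiv).trans
          (unitsMatrixDirPow F 6)))
    · obtain ⟨e⟩ := nonempty_algEquiv_C_three_of_mod_eq_two F 2 hp3 (by rw [hcard]; omega)
      obtain ⟨e₁⟩ := nonempty_golden_two_inert F 2 (by norm_num) (by rw [hcard]; omega)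
      obtain ⟨e₂⟩ := nonempty_units_mulEquiv_C hcard
      obtain ⟨e₃⟩ := nonempty_units_mulEquiv_C hcardE
      exact (isoSemidirect_units_of_char_two e e₁ hcardP).congr (.refl _) (.refl _)
        (((MulEquiv.prodUnits.trans (e₂.prodCongr e₃)).prodCongr
          ((Units.mapEquiv (matrixDirPow F (QuadExt F 2) 3).toMulEquiv).trans
            (unitsMatrixDirPow (QuadExt F 2) 3))).trans MulEquiv.prodAssoc)
  · rintro rfl
    have hmod : 5 ^ k % 6 = 1 ∨ 5 ^ k % 6 = 5 := by
      clear * -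
      induction k with
      | zero => simp
      | succ n ih => rw [pow_succ]; omega
    simp only [Int.ModEq]
    -- the common part of the two residue classes
    have key : IsoSemidirect (MonoidAlgebra F G)ˣ
          (oneAddJacobson (MonoidAlgebra F G)) (MonoidAlgebra F (C 6))ˣ ∧
        IsoSemidirect₂ (oneAddJacobson (MonoidAlgebra F G))
          (DirPow (C 5) (5 * (3 * k))) (DirPow (C 5) (2 * (3 * k))) (DirPow (C 5) (3 * k)) ∧
        Nonempty (Subgroup.center (oneAddJacobson (MonoidAlgebra F G)) ≃*
          DirPow (C 5) (3 * (3 * k))) := by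
      rcases hmod with h | h
      · obtain ⟨e⟩ := nonempty_algEquiv_C_three_of_mod_eq_one F 5 hp3 (by rw [hcard]; omega)
        exact structure_of_char_five e hcardD
      · obtain ⟨e⟩ := nonempty_algEquiv_C_three_of_mod_eq_two F 5 hp3 (by rw [hcard]; omega)
        exact structure_of_char_five e hcardP
    rw [← mul_assoc, ← mul_assoc, ← mul_assoc] at key
    obtain ⟨h1, h2, h3⟩ := key
    refine ⟨by omega, h1, fun h => ?_, fun h => ?_, h2, h3⟩
    · obtain ⟨e⟩ := nonempty_C_six_of_mod_eq_one F 5 (by norm_num) hp3 (by rw [hcard]; omega)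
      obtain ⟨e₁⟩ := nonempty_units_dirPow hcard 6
      have e₂ := (Units.mapEquiv e.toMulEquiv).trans e₁
      exact ⟨⟨e₂⟩, h1.congr (.refl _) (.refl _) e₂⟩
    · obtain ⟨e⟩ := nonempty_C_six_of_mod_eq_two F 5 (by norm_num) hp3 (by rw [hcard]; omega)
      obtain ⟨e₁⟩ := nonempty_units_prod_dirPow hcard hcardE 2 2
      have e₂ := (Units.mapEquiv e.toMulEquiv).trans e₁
      exact ⟨⟨e₂⟩, h1.congr (.refl _) (.refl _) e₂⟩
  · intro hp5
    have hmod2 : p ^ k % 2 ≠ 0 := fun h => by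
      have := (Nat.prime_dvd_prime_iff_eq Nat.prime_two hp).1
        (Nat.prime_two.dvd_of_dvd_pow (Nat.dvd_of_mod_eq_zero h))
      omega
    have hmod5 : p ^ k % 5 ≠ 0 := fun h => by
      have := (Nat.prime_dvd_prime_iff_eq Nat.prime_five hp).1
        (Nat.prime_five.dvd_of_dvd_pow (Nat.dvd_of_mod_eq_zero h))
      omega
    have hmod : p ^ k % 30 ∈ ({1, 7, 11, 13, 17, 19, 23, 29} : Finset ℕ) := by
      have h2 : p ^ k % 30 % 2 ≠ 0 := by omega
      have h3 : p ^ k % 30 % 3 ≠ 0 := by omega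
      have h5 : p ^ k % 30 % 5 ≠ 0 := by omega
      have h30 := Nat.mod_lt (p ^ k) (show 30 > 0 by norm_num)
      generalize p ^ k % 30 = r at h2 h3 h5 h30
      interval_cases r <;> simp at h2 h3 h5 ⊢
    simp only [Finset.mem_insert, Finset.mem_singleton] at hmod
    have hp2 : p ≠ 2 := by omega
    have hp5' : p ≠ 5 := by omega
    simp only [Int.ModEq]
    refine ⟨isSemisimpleRing_monoidAlgebra_G F p hp5, by omega, fun h => ?_, fun h => ?_,
      fun h => ?_, fun h => ?_⟩
    · obtain ⟨e⟩ := nonempty_algEquiv_one_split F p hp2 hp3 hp5' (by rw [hcard]; omega)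
        (by rw [hcard]; omega)
      obtain ⟨e₁⟩ := nonempty_units_dirPow hcard 6
      exact ⟨⟨e⟩, ⟨(Units.mapEquiv e.toMulEquiv).trans (MulEquiv.prodUnits.trans
        (e₁.prodCongr (unitsMatrixDirPow F 6)))⟩⟩
    · obtain ⟨e⟩ := nonempty_algEquiv_two_split F p hp2 hp3 hp5' (by rw [hcard]; omega)
        (by rw [hcard]; omega)
      obtain ⟨e₁⟩ := nonempty_units_dirPow hcard 2
      obtain ⟨e₂⟩ := nonempty_units_dirPow hcardE 2
      exact ⟨⟨e⟩, ⟨(Units.mapEquiv e.toMulEquiv).trans (MulEquiv.prodUnits.trans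
        (e₁.prodCongr (MulEquiv.prodUnits.trans (e₂.prodCongr (MulEquiv.prodUnits.trans
          ((unitsMatrixDirPow F 2).prodCongr (unitsMatrixDirPow (QuadExt F p) 2)))))))⟩⟩
    · obtain ⟨e⟩ := nonempty_algEquiv_one_inert F p hp2 hp3 hp5' (by rw [hcard]; omega)
        (by rw [hcard]; omega)
      obtain ⟨e₁⟩ := nonempty_units_dirPow hcard 6
      exact ⟨⟨e⟩, ⟨(Units.mapEquiv e.toMulEquiv).trans (MulEquiv.prodUnits.trans
        (e₁.prodCongr (unitsMatrixDirPow (QuadExt F p) 3)))⟩⟩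
    · obtain ⟨e⟩ := nonempty_algEquiv_two_inert F p hp2 hp3 hp5' (by rw [hcard]; omega)
        (by rw [hcard]; omega)
      obtain ⟨e₁⟩ := nonempty_units_dirPow hcard 2
      obtain ⟨e₂⟩ := nonempty_units_dirPow hcardE 2
      exact ⟨⟨e⟩, ⟨(Units.mapEquiv e.toMulEquiv).trans (MulEquiv.prodUnits.trans
        (e₁.prodCongr (MulEquiv.prodUnits.trans (e₂.prodCongr
          (unitsMatrixDirPow (QuadExt F p) 3)))))⟩⟩
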